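/- Let $(Y,Z,W)$ be a random vector in $\mathbb R\times\mathbb R^{d_z}\times\mathbb R^{d_w}$ with $Y=\varphi(Z)+U$ and $E[U\mid W]=0$, and let $(Y_i,Z_i,W_i)_{i\ge 1}$ be i.i.d. copies of it. Let $\nu$ be a probability density on $\mathbb R^{d_w}$, let $(f_j)_{j\ge1}$ be an orthonormal basis of $L^2_\nu(\mathbb R^{d_w})=\{\psi:\int\psi^2\nu<\infty\}$, let $\tau=(\tau_j)_{j\ge 1}$ be a sequence of weights, and write $f_j^\tau=\sqrt{\tau_j}\,f_j$. Assume: (A1) there are constants $\eta_f,\eta_p\ge1$ with $\sup_{l}\int|f_l|^4\nu\le\eta_f$ and, $W$ having a density $p_W$ and support $\mathcal W$, $\nu>0$ on $\mathcal W$ and $\sup_{w\in\mathcal W}p_W(w)/\nu(w)\le\eta_p$; (A2) $E[U^4\mid W]\le\sigma^4$ almost surely for some constant $\sigma>0$; (A3) $\tau$ is positive and nonincreasing with $\tau_1=1$. Let $\Theta\subset\mathbb R^k$ be compact, let $\phi:\mathbb R^{d_z}\times\mathbb R^k\to\mathbb R$ be measurable, and suppose that the null hypothesis $H_p$ holds: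 $\varphi=\phi(\cdot,\vartheta)$ ($Z$-almost surely) for some $\vartheta\in\Theta$. Let $\hat\vartheta_n$ be random vectors in $\mathbb R^k$ such that: (A4) $\|\hat\vartheta_n-\vartheta_0\|=O_p(n^{-1/2})$ for some $\vartheta_0\in\operatorname{int}(\Theta)$ with $\varphi=\phi(\cdot,\vartheta_0)$ ($Z$-almost surely); (A5) all first and second order partial derivatives $\phi_{\vartheta_l},\phi_{\vartheta_j\vartheta_l}$ of $\phi$ in its second argument exist on $\operatorname{int}(\Theta)$, and there is a constant $\eta_\phi\ge1$ with $E|\phi_{\vartheta_l}(Z,\vartheta_0)|^4\le\eta_\phi$ and $E\sup_{\theta\in\operatorname{int}(\Theta)}|\phi_{\vartheta_j\vartheta_l}(Z,\theta)|^4\le\eta_\phi$ for all $1\le j,l\le k$; (A6) with $V_i=(Y_i,Z_i,W_i,\vartheta_0)$, $V=(Y,Z,W,\vartheta_0)$ and real valued functions $h_1,\dots,h_k$ satisfying $E\,h_l(V)=0$ and $E|h_l(V)|^4<\infty$, $h=(h_1,\dots,h_k)^t$, $$\sqrt n(\hat\vartheta_n-\vartheta_0)=n^{-1/2}\sum_{i=1}^n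 h(V_i)+o_p(1).$$ Let $m_n$ be positive integers with $m_n\to\infty$ and $\sum_{j=1}^{m_n}\tau_j=O(1)$, and put $$S_n^p=\sum_{j=1}^{m_n}\tau_j\Big|n^{-1}\sum_{i=1}^n\big(Y_i-\phi(Z_i,\hat\vartheta_n)\big)f_j(W_i)\Big|^2 .$$ Let $\Sigma^p$ be the (infinite) covariance matrix, regarded as an operator on $\ell^2$, of the vector $$\Big(U f_j^\tau(W)-E\big[f_j^\tau(W)\,\phi_\vartheta(Z,\vartheta_0)^t\big]h(V)\Big)_{j\ge1}.$$ Then the nonincreasing sequence $(\lambda_j^p)_{j\ge 1}$ of eigenvalues of $\Sigma^p$ exists (each nonzero eigenvalue listed as often as its multiplicity, followed by zeros if there are only finitely many, $\lambda_j^p\to0$), it is summable, and for independent random variables $\chi^2_{1j}$, $j\ge 1$, that are chi-square distributed with one degree of freedom, the series $\sum_{j}\lambda_j^p\chi^2_{1j}$ converges almost surely and $$ n\,S_n^p\ \xrightarrow{\ d\ }\ \sum_{j=1}^\infty\lambda_j^p\,\chi^2_{1j}.$$ -/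

import Mathlib

open MeasureTheory ProbabilityTheory Filter Topology Asymptotics
open scoped ENNReal

namespace NPIV

noncomputable section

/-- Euclidean space `ℝ^d`. -/
abbrev Vec (d : ℕ) : Type := EuclideanSpace ℝ (Fin d)

/-- The space of observations `(y, z, w)`: scalar response, regressors, instruments. -/
abbrev Obs (dz dw : ℕ) : Type := ℝ × Vec dz × Vec dw

/-- The response `Y`. -/
def obsY {dz dw : ℕ} (x : Obs dz dw) : ℝ := x.1

/-- The regressors `Z`. -/
def obsZ {dz dw : ℕ} (x : Obs dz dw) : Vec dz := x.2.1

/-- The instruments `W`. -/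
def obsW {dz dw : ℕ} (x : Obs dz dw) : Vec dw := x.2.2

/-- The error term `U = Y - sol(Z)` belonging to the structural function `sol`. -/
def err {dz dw : ℕ} (sol : Vec dz → ℝ) (x : Obs dz dw) : ℝ := obsY x - sol (obsZ x)

/-- The sigma-algebra generated by the instruments `W`. -/
abbrev sigmaW (dz dw : ℕ) : MeasurableSpace (Obs dz dw) :=
  MeasurableSpace.comap obsW inferInstance

/-- The instrumental regression model `Y = sol(Z) + U`, `E[U | W] = 0`, where `P` is the joint law
of `(Y, Z, W)`. -/
structure IsModel {dz dw : ℕ} (P : Measure (Obs dz dw)) (sol : Vec dz → ℝ) : Prop where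
  measurable_sol : Measurable sol
  integrable_err : Integrable (err sol) P
  condExp_err : P[err sol | sigmaW dz dw] =ᵐ[P] 0

/-- The measure with Lebesgue density `p`. -/
def densityMeasure {d : ℕ} (p : Vec d → ℝ) : Measure (Vec d) :=
  volume.withDensity (fun w => ENNReal.ofReal (p w))

/-- `p` is a probability density with respect to Lebesgue measure. -/
structure IsProbDensity {d : ℕ} (p : Vec d → ℝ) : Prop where
  measurable : Measurable p
  nonneg : ∀ w, 0 ≤ p w
  isProbabilityMeasure : IsProbabilityMeasure (densityMeasure p)

/-- The functions `f 0, f 1, …` form an orthonormal basis of `L²_ν(ℝ^d)`. -/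
def IsOrthonormalBasisL2 {d : ℕ} (ν : Vec d → ℝ) (f : ℕ → Vec d → ℝ) : Prop :=
  (∀ j, Measurable (f j)) ∧
    ∃ b : HilbertBasis ℕ ℝ (Lp ℝ 2 (densityMeasure ν)), ∀ j, b j =ᵐ[densityMeasure ν] f j

/-- Uniformly bounded fourth `ν`-moments of the basis functions, and the density `pW` of the law of
`W` is bounded by a multiple of `ν`, where `ν` is strictly positive on the support of `W`. -/
structure BasisCondition {dz dw : ℕ} (P : Measure (Obs dz dw)) (ν : Vec dw → ℝ)
    (f : ℕ → Vec dw → ℝ) : Prop where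
  moments : ∃ ηf : ℝ, 1 ≤ ηf ∧ ∀ l, ∫⁻ w, ‖f l w‖ₑ ^ 4 ∂(densityMeasure ν) ≤ ENNReal.ofReal ηf
  pos : ∀ w ∈ (P.map obsW).support, 0 < ν w
  density : ∃ pW : Vec dw → ℝ, IsProbDensity pW ∧ P.map obsW = densityMeasure pW ∧
    ∃ ηp : ℝ, 1 ≤ ηp ∧ ∀ w ∈ (P.map obsW).support, pW w / ν w ≤ ηp

/-- `E[U⁴ | W] ≤ σ⁴` almost surely, for some `σ > 0`. -/
def ErrorMomentCondition {dz dw : ℕ} (P : Measure (Obs dz dw)) (sol : Vec dz → ℝ) : Prop :=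
  Integrable (fun x => err sol x ^ 4) P ∧
    ∃ σ : ℝ, 0 < σ ∧ P[fun x => err sol x ^ 4 | sigmaW dz dw] ≤ᵐ[P] fun _ => σ ^ 4

/-- The weights are positive and nonincreasing, and the first one is `1`. The index `j : ℕ` stands
for the index `j + 1` of the usual enumeration from `1`. -/
structure IsWeightSequence (τ : ℕ → ℝ) : Prop where
  pos : ∀ j, 0 < τ j
  antitone : Antitone τ
  first : τ 0 = 1

/-- The partial derivative of `g` with respect to the `l`-th coordinate. -/
def partialD {k : ℕ} (l : Fin k) (g : Vec k → ℝ) (θ : Vec k) : ℝ :=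
  lineDeriv ℝ g θ (EuclideanSpace.single l 1)

/-- All first and second order partial derivatives of `g` exist at every point of `s`. -/
def TwicePartiallyDifferentiableOn {k : ℕ} (g : Vec k → ℝ) (s : Set (Vec k)) : Prop :=
  ∀ θ ∈ s, ∀ l : Fin k, LineDifferentiableAt ℝ g θ (EuclideanSpace.single l 1) ∧
    ∀ j : Fin k, LineDifferentiableAt ℝ (partialD l g) θ (EuclideanSpace.single j 1)

/-- The parametric null hypothesis: `sol = φ(·, θ)` for some `θ ∈ Θ` (as functions of `Z`). -/
def ParametricNull {dz dw k : ℕ} (P : Measure (Obs dz dw)) (sol : Vec dz → ℝ)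
    (φ : Vec dz → Vec k → ℝ) (Θ : Set (Vec k)) : Prop :=
  ∃ θ ∈ Θ, ∀ᵐ x ∂P, sol (obsZ x) = φ (obsZ x) θ

/-- Smoothness in the parameter: second order partial derivatives exist in the interior of `Θ`, the
first ones at `θ₀` and the supremum over the interior of `Θ` of the second ones have bounded fourth
moments. -/
structure SmoothParametrization {dz dw k : ℕ} (P : Measure (Obs dz dw))
    (φ : Vec dz → Vec k → ℝ) (Θ : Set (Vec k)) (θ₀ : Vec k) : Prop where
  measurable : Measurable (fun q : Vec dz × Vec k => φ q.1 q.2)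
  differentiable : ∀ z, TwicePartiallyDifferentiableOn (φ z) (interior Θ)
  aemeasurable_sup : ∀ j l : Fin k, AEMeasurable
    (fun x => ⨆ θ ∈ interior Θ, ‖partialD j (partialD l (φ (obsZ x))) θ‖ₑ ^ 4) P
  moments : ∃ ηφ : ℝ, 1 ≤ ηφ ∧
    (∀ l : Fin k, ∫⁻ x, ‖partialD l (φ (obsZ x)) θ₀‖ₑ ^ 4 ∂P ≤ ENNReal.ofReal ηφ) ∧
    ∀ j l : Fin k, ∫⁻ x, ⨆ θ ∈ interior Θ, ‖partialD j (partialD l (φ (obsZ x))) θ‖ₑ ^ 4 ∂P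
      ≤ ENNReal.ofReal ηφ

/-- `X n = O_p(a n)`: for each `ε > 0` there are `C`, `N` with `μ(‖X n‖ > C a n) ≤ ε`, `n ≥ N`. -/
def IsBigOProb {Ω E : Type*} [MeasurableSpace Ω] [NormedAddCommGroup E] (μ : Measure Ω)
    (X : ℕ → Ω → E) (a : ℕ → ℝ) : Prop :=
  ∀ ε : ℝ, 0 < ε → ∃ C : ℝ, ∃ N : ℕ, ∀ n, N ≤ n →
    μ {ω | C * a n < ‖X n ω‖} ≤ ENNReal.ofReal ε

/-- The statistic `∑_{j ≤ m} τ_j |n⁻¹ ∑_{i ≤ n} (Y_i - φ(Z_i, θ)) f_j(W_i)|²`; the sample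
`x : ℕ → Obs dz dw` is numbered from `0` and only its first `n` members enter. -/
def testStat {dz dw k : ℕ} (φ : Vec dz → Vec k → ℝ) (f : ℕ → Vec dw → ℝ) (τ : ℕ → ℝ)
    (m n : ℕ) (θ : Vec k) (x : ℕ → Obs dz dw) : ℝ :=
  ∑ j ∈ Finset.range m, τ j *
    |(n : ℝ)⁻¹ * ∑ i ∈ Finset.range n, (obsY (x i) - φ (obsZ (x i)) θ) * f j (obsW (x i))| ^ 2

/-- `f_j^τ(w) = √τ_j f_j(w)`. -/
def wBasis {dw : ℕ} (τ : ℕ → ℝ) (f : ℕ → Vec dw → ℝ) (j : ℕ) (w : Vec dw) : ℝ :=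
  √(τ j) * f j w

/-- The `j`-th entry `U f_j^τ(W) - E[f_j^τ(W) φ_ϑ(Z, θ₀)ᵗ] h(V)`, with `V = (Y, Z, W, θ₀)`, of the
infinite dimensional vector whose covariance matrix governs the limit. -/
def score {dz dw k : ℕ} (P : Measure (Obs dz dw)) (sol : Vec dz → ℝ) (φ : Vec dz → Vec k → ℝ)
    (θ₀ : Vec k) (h : Fin k → Obs dz dw × Vec k → ℝ) (f : ℕ → Vec dw → ℝ) (τ : ℕ → ℝ)
    (j : ℕ) (x : Obs dz dw) : ℝ :=
  err sol x * wBasis τ f j (obsW x) -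
    ∑ l : Fin k, (∫ x', wBasis τ f j (obsW x') * partialD l (φ (obsZ x')) θ₀ ∂P) * h l (x, θ₀)

/-- The covariance matrix of `score`. -/
def covMatrix {dz dw k : ℕ} (P : Measure (Obs dz dw)) (sol : Vec dz → ℝ) (φ : Vec dz → Vec k → ℝ)
    (θ₀ : Vec k) (h : Fin k → Obs dz dw × Vec k → ℝ) (f : ℕ → Vec dw → ℝ) (τ : ℕ → ℝ) :
    ℕ → ℕ → ℝ :=
  fun i j => covariance (score P sol φ θ₀ h f τ i) (score P sol φ θ₀ h f τ j) P

/-- The space of `v ∈ ℓ²` with `S v = c v` for an infinite matrix `S`. -/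
def matrixEigenspace (S : ℕ → ℕ → ℝ) (c : ℝ) : Submodule ℝ (lp (fun _ : ℕ => ℝ) 2) where
  carrier := {v | ∀ i, HasSum (fun j => S i j * v j) (c * v i)}
  add_mem' := by
    intro v w hv hw i
    simpa [mul_add] using (hv i).add (hw i)
  zero_mem' := by
    intro i
    simp
  smul_mem' := by
    intro a v hv i
    simpa [mul_left_comm] using (hv i).mul_left a

/-- `lam` is the sequence of ordered eigenvalues of the infinite (positive semidefinite, compact)
matrix `S` on `ℓ²`: it is nonincreasing, tends to `0`, and lists each nonzero eigenvalue as many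
times as its multiplicity (followed by zeros if there are only finitely many). -/
structure IsOrderedEigenvalues (S : ℕ → ℕ → ℝ) (lam : ℕ → ℝ) : Prop where
  antitone : Antitone lam
  tendsto_zero : Tendsto lam atTop (𝓝 0)
  multiplicity : ∀ c : ℝ, c ≠ 0 →
    {j | lam j = c}.encard = Cardinal.toENat (Module.rank ℝ (matrixEigenspace S c))

/-- The sequence of ordered eigenvalues is uniquely determined by the matrix. -/
theorem IsOrderedEigenvalues.unique {S : ℕ → ℕ → ℝ} {a b : ℕ → ℝ}
    (ha : IsOrderedEigenvalues S a) (hb : IsOrderedEigenvalues S b) : a = b := by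
  have key : ∀ {a b : ℕ → ℝ}, IsOrderedEigenvalues S a → IsOrderedEigenvalues S b → ∀ i : ℕ,
      (∀ j < i, a j = b j) → a i ≤ b i := by
    intro a b ha hb i hi
    by_contra! hlt
    have hb0 : 0 ≤ b i := hb.antitone.le_of_tendsto hb.tendsto_zero i
    have hne : a i ≠ 0 := (lt_of_le_of_lt hb0 hlt).ne'
    have h1 := (ha.multiplicity _ hne).trans (hb.multiplicity _ hne).symm
    have hsub : {j | b j = a i} ⊆ Set.Iio i := by
      intro j hj
      by_contra hji
      have h2 := hb.antitone (not_lt.mp hji)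
      simp only [Set.mem_ofPred_eq] at hj
      linarith
    have hfin : {j | b j = a i}.Finite := (Set.finite_Iio i).subset hsub
    have hss : {j | b j = a i} ⊂ {j | a j = a i} := by
      refine ⟨fun j hj => ?_, fun hcon => ?_⟩
      · have := hi j (hsub hj)
        simp only [Set.mem_ofPred_eq] at hj ⊢
        linarith
      · have h3 := hsub (hcon (show a i = a i from rfl))
        simp at h3
    exact absurd h1 (hfin.encard_lt_encard hss).ne'
  funext i
  induction i using Nat.strong_induction_on with
  | _ i ih => exact le_antisymm (key ha hb i ih) (key hb ha i fun j hj => (ih j hj).symm)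

/-- The chi-square distribution with one degree of freedom. -/
def chiSquareOne : Measure ℝ := (gaussianReal 0 1).map (fun x => x ^ 2)

end

end NPIV

namespace NPIV

/-! Under the null, the residual is `U - (φ(Z, θhat) - φ(Z, θ₀))`. A second order Taylor expansion
in the parameter and the asymptotically linear form of `θhat` show that the vector of normalized
weighted moments, whose squared Euclidean norm is `n * testStat`, differs from `n^{-1/2} ∑
score(D_i)` by a vector of norm `o_p(1)` (`sum_sq_moment_remainder_le`,
`tendstoInMeasure_sum_sq_moment_remainder`). As the leading vector has a tight norm, the squared
norms also differ by `o_p(1)` (`abs_sum_sq_sub_sum_sq_le`), and Slutsky's lemma reduces the claim to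
the leading vector.

The score is a centred random element `X` of `ℓ²`: its unweighted coordinates have second moments
bounded uniformly in `j`, and the weights are summable, so `E‖X‖²` is finite. Its covariance matrix
is the Gram matrix of the vectors `X_j` in `L²(P)`, that is, the matrix of `A†A` with `A v = ∑ v_j
X_j`. The operator `A` is a norm limit of finite rank operators, so the spectral theorem for compact
symmetric operators supplies orthonormal eigenvectors `e_k`, and Tonelli's theorem gives the trace
identity `∑ λ_k = E‖X‖²` (`exists_orderedEigenvalues_gram`).

The coordinates `y_k = ⟨e_k, X⟩` are centred and uncorrelated with variances `λ_k`. For the first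
`K` of them the multivariate central limit theorem gives the limit `∑_{k<K} λ_k χ_k` for the sum of
squares. Replacing the full squared norm by this finite sum costs exactly `∑_{k≥K} λ_k` in `L¹`,
whatever `n ≥ 1` is; cutting off after `m n` original coordinates costs the tail of `∑ E X_j²`.
Since characteristic functions are Lipschitz for the `L¹` distance, these bounds close the argument
(`exists_tendstoInDistribution_weightedChiSquare`) with no restriction on the speed of `m n`. -/

/-! ### Decreasing rearrangement of families of reals. -/

/-- Only finitely many values exceed `c / 2`, so those below `c` cannot accumulate at `c`. The gap
below `c` lets the multiplicity of `c` be read off as a difference of two superlevel counts. -/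
theorem exists_lt_forall_le_of_finite_superlevel {κ : Type*} (b : κ → ℝ)
    (hb : ∀ ε : ℝ, 0 < ε → {i | ε < b i}.Finite) {c : ℝ} (hc : 0 < c) :
    ∃ s, s < c ∧ ∀ i, b i < c → b i ≤ s := by
  obtain h | h := ({i | c / 2 < b i ∧ b i < c}).eq_empty_or_nonempty
  · refine ⟨c / 2, by linarith, fun i hi => ?_⟩
    by_contra! h'
    exact Set.notMem_empty i (h ▸ ⟨h', hi⟩)
  · obtain ⟨i₀, hi₀, hmax⟩ := Set.exists_max_image _ b
      ((hb (c / 2) (by positivity)).subset fun i hi => hi.1) h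
    refine ⟨b i₀, hi₀.2, fun i hi => ?_⟩
    by_cases h' : c / 2 < b i
    · exact hmax i ⟨h', hi⟩
    · exact (not_lt.1 h').trans hi₀.1.le

theorem encard_superlevel_eq_add {κ : Type*} (b : κ → ℝ) {s c : ℝ} (hsc : s < c)
    (hb : ∀ i, b i < c → b i ≤ s) :
    {i | s < b i}.encard = {i | c < b i}.encard + {i | b i = c}.encard := by
  rw [← Set.encard_union_eq]
  · congr 1
    ext i
    simp only [Set.mem_ofPred_eq, Set.mem_union]
    constructor
    · intro h
      rcases lt_trichotomy (b i) c with h' | h' | h'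
      · exact absurd (hb i h') (not_le.2 h)
      · exact Or.inr h'
      · exact Or.inl h'
    · rintro (h | h)
      · exact hsc.trans h
      · rw [h]; exact hsc
  · rw [Set.disjoint_left]
    intro i hi hi'
    simp only [Set.mem_ofPred_eq] at hi hi'
    linarith

/-- Decreasing rearrangement of a family of nonnegative reals with finite superlevel sets. -/
theorem exists_antitone_rearrangement {ι : Type*} (a : ι → ℝ)
    (hfin : ∀ ε : ℝ, 0 < ε → {i | ε < a i}.Finite) :
    ∃ lam : ℕ → ℝ, Antitone lam ∧ (∀ k, 0 ≤ lam k) ∧ Tendsto lam atTop (𝓝 0) ∧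
      ∀ c : ℝ, 0 < c → {k | lam k = c}.encard = {i | a i = c}.encard := by
  set N : ℝ → ℕ∞ := fun t => {i | t < a i}.encard with hN
  have hNanti : Antitone N := fun s t hst => Set.encard_le_encard fun i hi => lt_of_le_of_lt hst hi
  have hNtop : ∀ t, 0 < t → N t ≠ ⊤ := fun t ht => (hfin t ht).encard_lt_top.ne
  -- The rearrangement is the generalized inverse of the counting function: `lam k` is the infimum
  -- of the levels `t ≥ 0` exceeded by at most `k` members.
  set L : ℕ → Set ℝ := fun k => {t | 0 ≤ t ∧ N t ≤ k} with hL
  have hLbdd : ∀ k, BddBelow (L k) := fun k => ⟨0, fun t ht => ht.1⟩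
  have hLne : ∀ k, (L k).Nonempty := by
    intro k
    obtain ⟨M, hM⟩ := ((hfin 1 one_pos).image a).bddAbove
    refine ⟨max M 1, le_max_of_le_right zero_le_one, ?_⟩
    have : {i | max M 1 < a i} = ∅ := by
      ext i
      simp only [Set.mem_ofPred_eq, Set.mem_empty_iff_false, iff_false, not_lt, max_lt_iff, not_and]
      intro hi
      by_contra! h1
      exact absurd (hM ⟨i, h1, rfl⟩) (not_le.2 hi)
    simp only [hN, this, Set.encard_empty, zero_le]
  set lam : ℕ → ℝ := fun k => sInf (L k) with hlam
  have hnonneg : ∀ k, 0 ≤ lam k := fun k => Real.sInf_nonneg fun t ht => ht.1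
  have hanti : Antitone lam := fun j k hjk =>
    csInf_le_csInf (hLbdd k) (hLne j) fun t ht => ⟨ht.1, ht.2.trans (by exact_mod_cast hjk)⟩
  have key : ∀ t, 0 ≤ t → ∀ k : ℕ, t < lam k ↔ (k : ℕ∞) < N t := by
    intro t ht k
    constructor
    · intro h
      by_contra! h'
      exact absurd (csInf_le (hLbdd k) (show t ∈ L k from ⟨ht, h'⟩)) (not_le.2 h)
    · intro h
      -- Choose `k + 1` members above `t`. Their minimum exceeds `t` and bounds `L k` from below,
      -- because a level under it would be exceeded by all `k + 1` of them.
      have h1 : ((k + 1 : ℕ) : ℕ∞) ≤ N t := by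
        simpa using Order.add_one_le_of_lt h
      obtain ⟨s, hs, hcard⟩ := Set.exists_subset_encard_eq h1
      have hsfin : s.Finite := Set.finite_of_encard_eq_coe hcard
      have hsne : s.Nonempty := by
        rw [← Set.encard_pos, hcard]; exact_mod_cast Nat.succ_pos k
      obtain ⟨i₀, hi₀, hmin⟩ := Set.exists_min_image s a hsfin hsne
      refine lt_of_lt_of_le (hs hi₀) (le_csInf (hLne k) fun u hu => ?_)
      by_contra! hlt
      have h2 : s.encard ≤ N u := Set.encard_le_encard fun i hi => lt_of_lt_of_le hlt (hmin i hi)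
      rw [hcard] at h2
      have h3 := h2.trans hu.2
      norm_cast at h3
      omega
  have hcount : ∀ t, 0 ≤ t → {k | t < lam k}.encard = N t := by
    intro t ht
    have h1 : {k | t < lam k} = {k : ℕ | (k : ℕ∞) < N t} := by
      ext k; exact key t ht k
    rw [h1]
    generalize N t = n
    induction n using ENat.recTopCoe with
    | top => simp
    | coe n =>
      have : {k : ℕ | (k : ℕ∞) < (n : ℕ∞)} = ↑(Finset.range n) := by ext; simp
      rw [this, Set.encard_coe_eq_coe_finsetCard, Finset.card_range]
  have hlamfin : ∀ t, 0 < t → {k | t < lam k}.Finite := fun t ht => by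
    rw [← Set.encard_ne_top_iff, hcount t ht.le]; exact hNtop t ht
  refine ⟨lam, hanti, hnonneg, ?_, ?_⟩
  · rw [Metric.tendsto_atTop]
    intro ε hε
    obtain ⟨M, hM⟩ := (hlamfin (ε / 2) (by positivity)).bddAbove
    refine ⟨M + 1, fun n hn => ?_⟩
    rw [Real.dist_eq, sub_zero, abs_of_nonneg (hnonneg n)]
    by_contra! h
    have : n ≤ M := hM (show ε / 2 < lam n by linarith)
    omega
  · intro c hc
    obtain ⟨s₁, hs₁, h₁⟩ := exists_lt_forall_le_of_finite_superlevel a hfin hc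
    obtain ⟨s₂, hs₂, h₂⟩ := exists_lt_forall_le_of_finite_superlevel lam hlamfin hc
    -- A gap below `c` common to both families, kept positive so that the superlevel counts are
    -- finite and agree at `s` and at `c`; cancelling the count at `c` leaves the multiplicities.
    set s := max (c / 2) (max s₁ s₂) with hs
    have hs0 : 0 < s := lt_of_lt_of_le (by positivity) (le_max_left _ _)
    have hsc : s < c := by simp [hs, hs₁, hs₂]; linarith
    have e1 := encard_superlevel_eq_add a hsc fun i hi => (h₁ i hi).trans ((le_max_left _ _).trans (le_max_right _ _))
    have e2 := encard_superlevel_eq_add lam hsc fun i hi => (h₂ i hi).trans ((le_max_right _ _).trans (le_max_right _ _))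
    rw [hcount s hs0.le, hcount c hc.le] at e2
    have e3 : N s = N c + {i | a i = c}.encard := e1
    rw [e2] at e3
    exact WithTop.add_left_cancel (hNtop c hc) e3

/-- Bijections between the fibres are glued together. Finiteness of the fibres is essential, since
two infinite sets of equal `encard` need not be equinumerous. -/
theorem exists_equiv_of_fiber_encard_eq {α β γ : Type*} (f : α → γ) (g : β → γ)
    (hfin : ∀ c, {a | f a = c}.Finite)
    (h : ∀ c, {a | f a = c}.encard = {b | g b = c}.encard) :
    ∃ σ : α ≃ β, ∀ a, g (σ a) = f a := by
  have hne : ∀ c, Nonempty ({a // f a = c} ≃ {b // g b = c}) := by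
    intro c
    have h1 : {b | g b = c}.Finite := by
      rw [← Set.encard_ne_top_iff, ← h c]; exact (hfin c).encard_lt_top.ne
    have := (hfin c).to_subtype
    have := h1.to_subtype
    have h2 : {a | f a = c}.ncard = {b | g b = c}.ncard := by rw [Set.ncard, Set.ncard, h c]
    exact ⟨(Finite.equivFinOfCardEq h2).trans (Finite.equivFin _).symm⟩
  exact ⟨Equiv.ofFiberEquiv fun c => (hne c).some, Equiv.ofFiberEquiv_map _⟩

/-! ### Gram operators on `ℓ²` and their eigenvalues. -/

/-- The space `ℓ²` of square summable real sequences. -/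
abbrev l2 : Type := lp (fun _ : ℕ => ℝ) 2

theorem hasSum_sq_l2 (v : l2) : HasSum (fun j => v j ^ 2) (‖v‖ ^ 2) := by
  have := lp.hasSum_inner (𝕜 := ℝ) v v
  rw [real_inner_self_eq_norm_sq] at this
  simpa [real_inner_self_eq_norm_sq] using this

/-- Cauchy–Schwarz in the index `j`. The bound does not depend on `s`, so it yields both the
absolute convergence of `∑ v_j x_j` and the boundedness of `synth`. -/
theorem sum_abs_mul_norm_le {H : Type*} [NormedAddCommGroup H] [InnerProductSpace ℝ H]
    {x : ℕ → H} (hx : Summable fun j => ‖x j‖ ^ 2) (v : l2) (s : Finset ℕ) :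
    ∑ j ∈ s, ‖v j • x j‖ ≤ ‖v‖ * √(∑' j, ‖x j‖ ^ 2) := by
  calc ∑ j ∈ s, ‖v j • x j‖ = ∑ j ∈ s, |v j| * ‖x j‖ := by simp [norm_smul]
    _ ≤ √(∑ j ∈ s, |v j| ^ 2) * √(∑ j ∈ s, ‖x j‖ ^ 2) := Real.sum_mul_le_sqrt_mul_sqrt _ _ _
    _ ≤ √(‖v‖ ^ 2) * √(∑' j, ‖x j‖ ^ 2) := by
        gcongr
        · simp only [sq_abs]
          exact sum_le_hasSum s (fun j _ => sq_nonneg _) (hasSum_sq_l2 v)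
        · exact hx.sum_le_tsum s fun j _ => sq_nonneg _
    _ = _ := by rw [Real.sqrt_sq (norm_nonneg _)]

theorem summable_norm_smul {H : Type*} [NormedAddCommGroup H] [InnerProductSpace ℝ H]
    [CompleteSpace H] {x : ℕ → H} (hx : Summable fun j => ‖x j‖ ^ 2) (v : l2) :
    Summable fun j => ‖v j • x j‖ :=
  summable_of_sum_le (fun _ => norm_nonneg _) (sum_abs_mul_norm_le hx v)

theorem norm_tsum_smul_le {H : Type*} [NormedAddCommGroup H] [InnerProductSpace ℝ H]
    [CompleteSpace H] {x : ℕ → H} (hx : Summable fun j => ‖x j‖ ^ 2) (v : l2) :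
    ‖∑' j, v j • x j‖ ≤ √(∑' j, ‖x j‖ ^ 2) * ‖v‖ := by
  rw [mul_comm]
  exact (norm_tsum_le_tsum_norm (summable_norm_smul hx v)).trans
    (Real.tsum_le_of_sum_le (fun _ => norm_nonneg _) (sum_abs_mul_norm_le hx v))

/-- The operator `v ↦ ∑ v_j x_j` from `ℓ²` to `H`, for a square summable sequence `x`. -/
noncomputable def synth {H : Type*} [NormedAddCommGroup H] [InnerProductSpace ℝ H]
    [CompleteSpace H] (x : ℕ → H) (hx : Summable fun j => ‖x j‖ ^ 2) : l2 →L[ℝ] H :=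
  LinearMap.mkContinuous
    { toFun := fun v => ∑' j, v j • x j
      map_add' := fun v w => by
        simp only [lp.coeFn_add, Pi.add_apply, add_smul]
        exact (summable_norm_smul hx v).of_norm.tsum_add (summable_norm_smul hx w).of_norm
      map_smul' := fun c v => by
        simp only [lp.coeFn_smul, Pi.smul_apply, smul_assoc, RingHom.id_apply]
        exact (summable_norm_smul hx v).of_norm.tsum_const_smul c }
    (√(∑' j, ‖x j‖ ^ 2)) (fun v => norm_tsum_smul_le hx v)

theorem hasSum_synth {H : Type*} [NormedAddCommGroup H] [InnerProductSpace ℝ H]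
    [CompleteSpace H] {x : ℕ → H} (hx : Summable fun j => ‖x j‖ ^ 2) (v : l2) :
    HasSum (fun j => v j • x j) (synth x hx v) := (summable_norm_smul hx v).of_norm.hasSum

theorem synth_single {H : Type*} [NormedAddCommGroup H] [InnerProductSpace ℝ H]
    [CompleteSpace H] {x : ℕ → H} (hx : Summable fun j => ‖x j‖ ^ 2) (i : ℕ) :
    synth x hx (lp.single 2 i (1 : ℝ)) = x i := by
  refine (hasSum_synth hx _).unique ?_
  convert hasSum_single i ?_ using 1
  · simp
  · intro j hj
    simp [lp.single_apply, hj]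

/-- Keeping only the first `N` vectors gives finite rank operators, and the error in operator norm
is at most the square root of the tail of `∑ ‖x_j‖²`. -/
theorem isCompactOperator_synth {H : Type*} [NormedAddCommGroup H] [InnerProductSpace ℝ H]
    [CompleteSpace H] {x : ℕ → H} (hx : Summable fun j => ‖x j‖ ^ 2) :
    IsCompactOperator (synth x hx) := by
  have htr : ∀ N : ℕ, Summable fun j => ‖if j < N then x j else 0‖ ^ 2 := fun N =>
    hx.of_nonneg_of_le (fun _ => sq_nonneg _) fun j => by split_ifs <;> simp
  refine isCompactOperator_of_tendsto (l := atTop) (F := fun N => synth _ (htr N)) ?_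
    (.of_forall fun N => ?_)
  · rw [tendsto_iff_norm_sub_tendsto_zero]
    have htail : Tendsto (fun N => √(∑' j, ‖x (j + N)‖ ^ 2)) atTop (𝓝 0) := by
      have := (tendsto_sum_nat_add fun j => ‖x j‖ ^ 2).sqrt
      simpa using this
    refine squeeze_zero (fun _ => norm_nonneg _) (fun N => ?_) htail
    refine ContinuousLinearMap.opNorm_le_bound _ (Real.sqrt_nonneg _) fun v => ?_
    have hx' : Summable fun j => ‖if j < N then 0 else x j‖ ^ 2 :=
      hx.of_nonneg_of_le (fun _ => sq_nonneg _) fun j => by split_ifs <;> simp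
    have h1 : (synth _ (htr N) - synth x hx) v = - synth _ hx' v := by
      refine HasSum.unique ((hasSum_synth (htr N) v).sub (hasSum_synth hx v)) ?_
      convert (hasSum_synth hx' v).neg using 2 with j
      split_ifs <;> simp
    rw [h1, norm_neg]
    refine (norm_tsum_smul_le hx' v).trans (le_of_eq ?_)
    congr 2
    rw [← hx'.sum_add_tsum_nat_add N, Finset.sum_eq_zero, zero_add]
    · simp
    · intro j hj
      simp [Finset.mem_range.1 hj]
  -- The truncated operator is a finite sum of the rank one maps `v ↦ v_j x_j`, each factoring
  -- through `ℝ`.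
  · have h1 : synth _ (htr N) = ∑ j ∈ Finset.range N,
        ((innerSL ℝ (lp.single 2 j (1 : ℝ) : l2)).smulRight (x j)) := by
      ext v
      refine (hasSum_synth (htr N) v).unique ?_
      simp only [sum_apply, ContinuousLinearMap.smulRight_apply,
        innerSL_apply_apply, lp.inner_single_left]
      convert hasSum_sum_of_ne_finset_zero (s := Finset.range N)
        (L := SummationFilter.unconditional ℕ) ?_ using 1
      · refine Finset.sum_congr rfl fun j hj => ?_
        simp [Finset.mem_range.1 hj]
      · intro j hj
        simp [Finset.mem_range.not.1 hj]
    rw [h1]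
    refine Submodule.sum_mem (compactOperator (RingHom.id ℝ) l2 H) fun j _ => ?_
    exact (isCompactOperator_of_locallyCompactSpace_dom
      (innerSL ℝ (lp.single 2 j (1 : ℝ) : l2))).continuous_comp
      (g := fun t : ℝ => t • x j) (by fun_prop)

theorem hasSum_of_forall_eq {ι : Type*} {f g : ι → ℝ} {c : ℝ} (hg : HasSum g c)
    (h : ∀ i, f i = g i) : HasSum f c := by
  rwa [show f = g from funext h]

section Gram

variable {H : Type*} [NormedAddCommGroup H] [InnerProductSpace ℝ H] [CompleteSpace H]

/-- The Gram operator `A†A` on `ℓ²`, where `A v = ∑ v_j x_j`. -/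
noncomputable def gramOp (x : ℕ → H) (hx : Summable fun j => ‖x j‖ ^ 2) : l2 →L[ℝ] l2 :=
  (synth x hx).adjoint ∘L synth x hx

variable {x : ℕ → H} (hx : Summable fun j => ‖x j‖ ^ 2)

theorem inner_gramOp (v w : l2) :
    inner ℝ v (gramOp x hx w) = inner ℝ (synth x hx v) (synth x hx w) :=
  ContinuousLinearMap.adjoint_inner_right (synth x hx) v (synth x hx w)

theorem gramOp_isSymmetric : (gramOp x hx : l2 →ₗ[ℝ] l2).IsSymmetric := by
  intro v w
  change inner ℝ (gramOp x hx v) w = inner ℝ v (gramOp x hx w)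
  rw [real_inner_comm, inner_gramOp, inner_gramOp, real_inner_comm]

theorem isCompactOperator_gramOp : IsCompactOperator (gramOp x hx) :=
  (isCompactOperator_synth hx).clm_comp (synth x hx).adjoint

/-- With `A = synth x hx` and `δ_i` the unit vector, the `i`-th coordinate of `A†A v` is `⟨A δ_i, A
v⟩ = ⟨x_i, A v⟩`. Hence `gramOp` acts by the row sums of the Gram matrix, which converge
automatically. -/
theorem hasSum_gramOp (v : l2) (i : ℕ) :
    HasSum (fun j => inner ℝ (x i) (x j) * v j) (gramOp x hx v i) := by
  have h1 : gramOp x hx v i = inner ℝ (x i) (synth x hx v) := by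
    rw [← synth_single hx i, ← inner_gramOp, lp.inner_single_left]
    simp
  rw [h1]
  refine hasSum_of_forall_eq ((hasSum_synth hx v).mapL (innerSL ℝ (x i))) fun j => ?_
  rw [innerSL_apply_apply, inner_smul_right, mul_comm]

/-- The bridge from eigenvalues defined through row sums to the spectral theory of bounded
operators. -/
theorem matrixEigenspace_gram (c : ℝ) :
    matrixEigenspace (fun i j => inner ℝ (x i) (x j)) c =
      Module.End.eigenspace (gramOp x hx : Module.End ℝ l2) c := by
  ext v
  rw [Module.End.mem_eigenspace_iff]
  constructor
  · intro h
    ext i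
    exact (hasSum_gramOp hx v i).unique (h i)
  · intro h i
    have h1 := hasSum_gramOp hx v i
    have h2 : gramOp x hx v = c • v := h
    rw [h2] at h1
    simpa using h1

/-- Pairing the eigenvalue equation with `v` gives `c ‖v‖² = ‖A v‖² ≥ 0`. -/
theorem eigenspace_gramOp_eq_bot_of_neg {c : ℝ} (hc : c < 0) :
    Module.End.eigenspace (gramOp x hx : Module.End ℝ l2) c = ⊥ := by
  rw [eq_bot_iff]
  intro v hv
  have h2 : gramOp x hx v = c • v := Module.End.mem_eigenspace_iff.1 hv
  have h3 := inner_gramOp hx v v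
  rw [h2, inner_smul_right, real_inner_self_eq_norm_sq, real_inner_self_eq_norm_sq] at h3
  have h4 : ‖v‖ ^ 2 = 0 := by nlinarith [sq_nonneg ‖v‖, sq_nonneg ‖synth x hx v‖]
  simpa using h4

/-- An orthonormal family of eigenvectors that exhausts all eigenspaces for nonzero eigenvalues
resolves the diagonal entries of the Gram matrix. -/
theorem hasSum_eigenvalue_mul_sq {ι : Type*} {v : ι → l2} (hv : Orthonormal ℝ v) (a : ι → ℝ)
    (hva : ∀ i, gramOp x hx (v i) = a i • v i)
    (hex : ∀ c : ℝ, c ≠ 0 → Module.End.eigenspace (gramOp x hx : Module.End ℝ l2) c ≤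
      Submodule.span ℝ (Set.range v)) (j : ℕ) :
    HasSum (fun i => a i * (v i j) ^ 2) (‖x j‖ ^ 2) := by
  obtain ⟨w, b, hsw, hb⟩ := hv.toSubtypeRange.exists_hilbertBasis_extension
  -- The vectors added to complete `v` to a Hilbert basis lie in the kernel. Such a `u` is
  -- orthogonal to every eigenspace of nonzero eigenvalue, so by symmetry its image is orthogonal to
  -- all eigenspaces, that of `0` included; for a compact symmetric operator only `0` has this
  -- property.
  have hker : ∀ u : w, (u : l2) ∉ Set.range v → gramOp x hx u = 0 := by
    intro u hu
    have h1 : (u : l2) ∈ (Submodule.span ℝ (Set.range v))ᗮ := by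
      rw [Submodule.mem_orthogonal]
      intro y hy
      induction hy using Submodule.span_induction with
      | mem y hy =>
        have hne : (⟨y, hsw hy⟩ : w) ≠ u := by rintro rfl; exact hu hy
        have := b.orthonormal.2 hne
        simpa [hb] using this
      | zero => simp
      | add y z _ _ h1 h2 => rw [inner_add_left, h1, h2, add_zero]
      | smul c y _ h1 => rw [inner_smul_left, h1, mul_zero]
    have h2 : gramOp x hx u ∈
        (⨆ μ, Module.End.eigenspace (gramOp x hx : Module.End ℝ l2) μ)ᗮ := by
      rw [Submodule.mem_orthogonal]
      intro y hy
      refine Submodule.iSup_induction _ (motive := fun y => inner ℝ y (gramOp x hx u) = 0) hy ?_ ?_ ?_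
      · intro c y hy
        have h3 : gramOp x hx y = c • y := Module.End.mem_eigenspace_iff.1 hy
        have h4 : inner ℝ y (gramOp x hx u) = c * inner ℝ y (u : l2) := by
          have := gramOp_isSymmetric hx y u
          simp only [ContinuousLinearMap.coe_coe] at this
          rw [← this, h3, inner_smul_left]; simp
        rw [h4]
        by_cases hc : c = 0
        · simp [hc]
        · rw [(Submodule.mem_orthogonal _ _).1 h1 y (hex c hc hy), mul_zero]
      · simp
      · intro y z h1 h2
        rw [inner_add_left, h1, h2, add_zero]
    rw [ContinuousLinearMap.orthogonalComplement_iSup_eigenspaces_eq_bot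
      (isCompactOperator_gramOp hx) (gramOp_isSymmetric hx)] at h2
    simpa using h2
  set d : l2 := lp.single 2 j (1 : ℝ) with hd
  -- Parseval for `⟨G d, d⟩ = ‖x_j‖²`, where `G` is the Gram operator and `d` the `j`-th unit
  -- vector. Only the basis vectors in the range of `v` contribute.
  have hsum := b.hasSum_inner_mul_inner (gramOp x hx d) d
  have hval : inner ℝ (gramOp x hx d) d = ‖x j‖ ^ 2 := by
    rw [real_inner_comm, inner_gramOp, hd, synth_single, real_inner_self_eq_norm_sq]
  rw [hval, hb] at hsum
  set g : ι → w := fun i => ⟨v i, hsw ⟨i, rfl⟩⟩ with hg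
  have hginj : Function.Injective g := fun i i' h => hv.linearIndependent.injective
    (congrArg Subtype.val h)
  have hcoord : ∀ u : l2, inner ℝ u d = u j := fun u => by
    rw [hd, lp.inner_single_right]; simp
  have hsymm : ∀ u : l2, inner ℝ (gramOp x hx d) u = gramOp x hx u j := fun u => by
    have := gramOp_isSymmetric hx d u
    simp only [ContinuousLinearMap.coe_coe] at this
    rw [this, real_inner_comm, hcoord]
  rw [← hginj.hasSum_iff] at hsum
  · refine hasSum_of_forall_eq hsum fun i => ?_
    have h1 : gramOp x hx (v i) j = a i * v i j := by rw [hva]; rfl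
    change _ = inner ℝ (gramOp x hx d) (v i) * inner ℝ (v i) d
    rw [hsymm, hcoord, h1]
    ring
  · intro u hu
    have : (u : l2) ∉ Set.range v := by
      rintro ⟨i, hi⟩
      exact hu ⟨i, Subtype.ext hi⟩
    rw [hsymm, hker u this]
    simp

end Gram

/-- Orthonormal eigenvectors that exhaust the eigenspaces of a positive compact operator for
nonzero eigenvalues. -/
theorem exists_orthonormal_eigenvectors {F : Type} [NormedAddCommGroup F] [InnerProductSpace ℝ F]
    [CompleteSpace F] {T : F →L[ℝ] F} (hT : IsCompactOperator T)
    (hT' : (T : F →ₗ[ℝ] F).IsSymmetric)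
    (hneg : ∀ c : ℝ, c < 0 → Module.End.eigenspace (T : Module.End ℝ F) c = ⊥) :
    ∃ (ι : Type) (v : ι → F) (a : ι → ℝ), Orthonormal ℝ v ∧ (∀ i, 0 < a i) ∧
      (∀ i, T (v i) = a i • v i) ∧
      (∀ c : ℝ, c ≠ 0 → Module.End.eigenspace (T : Module.End ℝ F) c ≤
        Submodule.span ℝ (Set.range v)) ∧
      ∀ c : ℝ, 0 < c → {i | a i = c}.encard = Cardinal.toENat
        (Module.rank ℝ (Module.End.eigenspace (T : Module.End ℝ F) c)) := by
  set E : ℝ → Submodule ℝ F := fun c => Module.End.eigenspace (T : Module.End ℝ F) c with hE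
  have hfd : ∀ c : {c : ℝ // 0 < c}, FiniteDimensional ℝ (E c) := fun c =>
    ContinuousLinearMap.finite_dimensional_eigenspace hT c.1 c.2.ne'
  let B : ∀ c : {c : ℝ // 0 < c}, OrthonormalBasis (Fin (Module.finrank ℝ (E c))) ℝ (E c) :=
    fun c => stdOrthonormalBasis ℝ (E c)
  -- Each eigenspace carries its own orthonormal basis, finite by compactness; symmetry makes the
  -- eigenspaces mutually orthogonal, so the union of the bases is orthonormal.
  have hv0 : Orthonormal ℝ fun i : (Σ c : {c : ℝ // 0 < c}, Fin (Module.finrank ℝ (E c))) =>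
      (B i.1 i.2 : F) :=
    (hT'.orthogonalFamily_eigenspaces.comp
      (Subtype.val_injective (p := fun c : ℝ => 0 < c))).orthonormal_sigma_orthonormal
      fun c => (B c).orthonormal
  refine ⟨Σ c : {c : ℝ // 0 < c}, Fin (Module.finrank ℝ (E c)), fun i => (B i.1 i.2 : F),
    fun i => i.1.1, hv0, fun i => i.1.2,
    fun i => Module.End.mem_eigenspace_iff.1 (B i.1 i.2).2, ?_, ?_⟩
  · intro c hc
    rcases lt_or_gt_of_ne hc with h | h
    · rw [hneg c h]
      exact bot_le
    · intro y hy
      have h1 : (⟨y, hy⟩ : E c) = ∑ i, (B ⟨c, h⟩).repr ⟨y, hy⟩ i • B ⟨c, h⟩ i :=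
        ((B ⟨c, h⟩).sum_repr _).symm
      have h2 : y = ∑ i, (B ⟨c, h⟩).repr ⟨y, hy⟩ i • (B ⟨c, h⟩ i : F) := by
        have h3 := congrArg (Submodule.subtype (E c)) h1
        rw [map_sum] at h3
        exact h3
      rw [h2]
      refine Submodule.sum_mem _ fun i _ => Submodule.smul_mem _ _ (Submodule.subset_span ?_)
      exact ⟨⟨⟨c, h⟩, i⟩, rfl⟩
  · intro c hc
    have h1 : {i : (Σ c : {c : ℝ // 0 < c}, Fin (Module.finrank ℝ (E c))) | i.1.1 = c} =
        Set.range fun n : Fin (Module.finrank ℝ (E c)) => ⟨⟨c, hc⟩, n⟩ := by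
      ext ⟨⟨c', hc'⟩, n⟩
      simp only [Set.mem_ofPred_eq, Set.mem_range]
      constructor
      · rintro rfl; exact ⟨n, rfl⟩
      · rintro ⟨m, hm⟩
        exact (congrArg (fun i : (Σ c : {c : ℝ // 0 < c}, Fin (Module.finrank ℝ (E c))) => i.1.1)
          hm).symm
    rw [h1, ← Set.image_univ, Function.Injective.encard_image, Set.encard_univ]
    · have := hfd ⟨c, hc⟩
      have h2 := Module.finrank_eq_rank ℝ (E c)
      change _ = Cardinal.toENat (Module.rank ℝ (E c))
      rw [← h2]
      simp
    · intro m n h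
      simpa using h

section Gram

variable {H : Type*} [NormedAddCommGroup H] [InnerProductSpace ℝ H] [CompleteSpace H]
variable {x : ℕ → H} (hx : Summable fun j => ‖x j‖ ^ 2)

/-- The trace identity. Summing `a_i (v_i)_j²` over `j` gives `a_i`, because `v_i` is a unit vector;
summing over `i` gives `‖x_j‖²`. All terms are nonnegative, so the order of summation is free. -/
theorem hasSum_eigenvalues_gramOp {ι : Type*} {v : ι → l2} (hv : Orthonormal ℝ v) {a : ι → ℝ}
    (hapos : ∀ i, 0 < a i) (hva : ∀ i, gramOp x hx (v i) = a i • v i)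
    (hex : ∀ c : ℝ, c ≠ 0 → Module.End.eigenspace (gramOp x hx : Module.End ℝ l2) c ≤
      Submodule.span ℝ (Set.range v)) :
    HasSum a (∑' j, ‖x j‖ ^ 2) := by
  have hdiag := hasSum_eigenvalue_mul_sq hx hv a hva hex
  have hvsq : ∀ i, HasSum (fun j => a i * v i j ^ 2) (a i) := fun i => by
    simpa [hv.1 i] using (hasSum_sq_l2 (v i)).mul_left (a i)
  have hpart : ∀ s : Finset ι, ∑ i ∈ s, a i ≤ ∑' j, ‖x j‖ ^ 2 := by
    intro s
    refine hasSum_le (fun j => ?_) (hasSum_sum fun i _ => hvsq i) hx.hasSum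
    exact sum_le_hasSum s (fun i _ => mul_nonneg (hapos i).le (sq_nonneg _)) (hdiag j)
  have hasum : Summable a := summable_of_sum_le (fun i => (hapos i).le) hpart
  have h1 : Summable (fun p : ι × ℕ => a p.1 * v p.1 p.2 ^ 2) := by
    rw [summable_prod_of_nonneg fun p => mul_nonneg (hapos _).le (sq_nonneg _)]
    refine ⟨fun i => (hvsq i).summable, ?_⟩
    simpa only [(hvsq _).tsum_eq] using hasum
  have h2 := h1.tsum_comm (f := fun (i : ι) (j : ℕ) => a i * v i j ^ 2)
  simp only [(hvsq _).tsum_eq, (hdiag _).tsum_eq] at h2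
  rw [h2]
  exact hasum.hasSum

end Gram

/-- The decreasing enumeration of a summable family of positive reals, padded with zeros. -/
theorem exists_antitone_enumeration {ι : Type*} {a : ι → ℝ} (hapos : ∀ i, 0 < a i)
    (hasum : Summable a) :
    ∃ (lam : ℕ → ℝ) (σ : {k // 0 < lam k} ≃ ι), Antitone lam ∧ (∀ k, 0 ≤ lam k) ∧
      Tendsto lam atTop (𝓝 0) ∧ (∀ k, a (σ k) = lam k) ∧
      ∀ c : ℝ, 0 < c → {k | lam k = c}.encard = {i | a i = c}.encard := by
  obtain ⟨lam, hanti, hnn, hlim, hmult⟩ := exists_antitone_rearrangement a fun ε hε => by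
    have h := hasum.tendsto_cofinite_zero.eventually (gt_mem_nhds hε)
    rw [Filter.eventually_cofinite] at h
    exact h.subset fun i (hi : ε < a i) => not_lt.2 hi.le
  -- Only the positive entries of `lam` are matched with `ι`: the padding zeros correspond to no
  -- index, since every `a i` is positive.
  obtain ⟨σ, hσ⟩ : ∃ σ : {k // 0 < lam k} ≃ ι, ∀ k, a (σ k) = lam k := by
    refine exists_equiv_of_fiber_encard_eq (fun k : {k // 0 < lam k} => lam k) a ?_ ?_
    all_goals intro c
    all_goals
      have h1 : {k : {k // 0 < lam k} | lam k = c}.encard =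
          {k | 0 < lam k ∧ lam k = c}.encard := by
        rw [← Subtype.val_injective.encard_image]
        congr 1
        ext k
        simp [and_comm]
    all_goals rcases le_or_gt c 0 with hc | hc
    · convert Set.finite_empty
      ext k
      simp only [Set.mem_ofPred_eq, Set.mem_empty_iff_false, iff_false]
      intro h
      linarith [k.2]
    · rw [← Set.encard_ne_top_iff, h1]
      have h2 : {k | 0 < lam k ∧ lam k = c} = {k | lam k = c} := by
        ext k
        simp only [Set.mem_ofPred_eq, and_iff_right_iff_imp]
        rintro rfl; exact hc
      rw [h2]
      refine Set.Finite.encard_lt_top (Set.Finite.subset ?_ fun k (hk : lam k = c) =>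
        (show c / 2 < lam k by linarith)) |>.ne
      have h3 := hlim.eventually (gt_mem_nhds (half_pos hc))
      rw [← Nat.cofinite_eq_atTop, Filter.eventually_cofinite] at h3
      exact h3.subset fun i (hi : c / 2 < lam i) => not_lt.2 hi.le
    · have h2 : {k | 0 < lam k ∧ lam k = c} = ∅ := by
        ext k
        simp only [Set.mem_ofPred_eq, Set.mem_empty_iff_false, iff_false, not_and]
        rintro h rfl; linarith
      have h3 : {i | a i = c} = ∅ := by
        ext i
        simp only [Set.mem_ofPred_eq, Set.mem_empty_iff_false, iff_false]
        rintro rfl; linarith [hapos i]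
      rw [h1, h2, h3]; simp
    · have h2 : {k | 0 < lam k ∧ lam k = c} = {k | lam k = c} := by
        ext k
        simp only [Set.mem_ofPred_eq, and_iff_right_iff_imp]
        rintro rfl; exact hc
      rw [h1, h2, hmult c hc]
  exact ⟨lam, σ, hanti, hnn, hlim, hσ, hmult⟩

section Gram

variable {H : Type*} [NormedAddCommGroup H] [InnerProductSpace ℝ H] [CompleteSpace H]
variable {x : ℕ → H} (hx : Summable fun j => ‖x j‖ ^ 2)

/-- The eigenvalues of a Gram matrix of finite trace, with orthonormal eigenvectors. -/
theorem exists_orderedEigenvalues_gram :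
    ∃ (lam : ℕ → ℝ) (e : ℕ → l2),
      IsOrderedEigenvalues (fun i j => inner ℝ (x i) (x j)) lam ∧ (∀ k, 0 ≤ lam k) ∧
      HasSum lam (∑' j, ‖x j‖ ^ 2) ∧
      (∀ (v : l2) (K : ℕ), ∑ k ∈ Finset.range K, inner ℝ (e k) v ^ 2 ≤ ‖v‖ ^ 2) ∧
      ∀ k l, inner ℝ (synth x hx (e k)) (synth x hx (e l)) = if k = l then lam k else 0 := by
  obtain ⟨ι, v, a, hv, hapos, hva, hex, hcard⟩ := exists_orthonormal_eigenvectors (isCompactOperator_gramOp hx)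
    (gramOp_isSymmetric hx) fun _ => eigenspace_gramOp_eq_bot_of_neg hx
  have htr := hasSum_eigenvalues_gramOp hx hv hapos hva hex
  obtain ⟨lam, σ, hanti, hnn, hlim, hσ, hmult⟩ := exists_antitone_enumeration hapos htr.summable
  classical
  -- At padding positions `e k` is the zero vector. The family is then not orthonormal, but Bessel's
  -- inequality and the orthogonality relations with `lam k = 0` survive.
  let e : ℕ → l2 := fun k => if h : 0 < lam k then v (σ ⟨k, h⟩) else 0
  have he : ∀ k (h : 0 < lam k), e k = v (σ ⟨k, h⟩) := fun k h => by simp only [e, dif_pos h]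
  have he0 : ∀ k, ¬ 0 < lam k → e k = 0 := fun k h => by simp only [e, dif_neg h]
  refine ⟨lam, e, ⟨hanti, hlim, ?_⟩, hnn, ?_, ?_, ?_⟩
  · intro c hc
    rw [matrixEigenspace_gram hx]
    rcases lt_or_gt_of_ne hc with h | h
    · rw [eigenspace_gramOp_eq_bot_of_neg hx h]
      have : {j | lam j = c} = ∅ := by
        ext k
        simp only [Set.mem_ofPred_eq, Set.mem_empty_iff_false, iff_false]
        rintro rfl; linarith [hnn k]
      simp [this]
    · rw [hmult c h, hcard c h]
  · have h1 : HasSum (fun k : {k // 0 < lam k} => lam k) (∑' j, ‖x j‖ ^ 2) := by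
      rw [← σ.hasSum_iff] at htr
      convert htr using 2 with k
      exact (hσ k).symm
    exact (hasSum_subtype_iff_of_support_subset (s := {k | 0 < lam k})
      fun k hk => lt_of_le_of_ne (hnn k) (Ne.symm hk)).1 h1
  · intro w K
    have h1 : Orthonormal ℝ (v ∘ σ) := hv.comp σ σ.injective
    have h2 := h1.sum_inner_products_le w (s := (Finset.range K).subtype fun k => 0 < lam k)
    simp only [Real.norm_eq_abs, sq_abs] at h2
    refine le_trans (le_of_eq ?_) h2
    have h3 := Finset.sum_subtype_eq_sum_filter (s := Finset.range K) (p := fun k => 0 < lam k)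
      (f := fun k => inner ℝ (e k) w ^ 2)
    rw [Finset.sum_filter_of_ne] at h3
    · rw [← h3]
      exact Finset.sum_congr rfl fun k _ => by rw [he k.1 k.2]; rfl
    · intro k _ hk
      by_contra h
      exact hk (by rw [he0 k h]; simp)
  · intro k l
    rw [← inner_gramOp]
    by_cases hk : 0 < lam k <;> by_cases hl : 0 < lam l
    · rw [he k hk, he l hl, hva, inner_smul_right, hσ,
        orthonormal_iff_ite.1 hv]
      simp only [σ.injective.eq_iff, Subtype.mk.injEq]
      split_ifs with h
      · rw [h, mul_one]
      · rw [mul_zero]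
    · rw [he0 l hl]
      have : k ≠ l := by rintro rfl; exact hl hk
      simp [this]
    · rw [he0 k hk]
      have : k ≠ l := by rintro rfl; exact hk hl
      simp [this]
    · rw [he0 k hk]
      have : lam k = 0 := le_antisymm (not_lt.1 hk) (hnn k)
      simp [this]

end Gram

/-! ### Series of nonnegative functions, and characteristic functions of close variables. -/

section Series

variable {α : Type*} [MeasurableSpace α] {P : Measure α}

/-- By Tonelli's theorem the sum of the series has a finite integral, hence is finite almost
everywhere. -/
theorem ae_summable_of_summable_integral {g : ℕ → α → ℝ} (hg : ∀ j, Integrable (g j) P)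
    (hnn : ∀ j, 0 ≤ᵐ[P] g j) (hs : Summable fun j => ∫ a, g j a ∂P) :
    ∀ᵐ a ∂P, Summable fun j => g j a := by
  have h1 : ∫⁻ a, ∑' j, ENNReal.ofReal (g j a) ∂P ≠ ∞ := by
    rw [lintegral_tsum fun j => (hg j).aemeasurable.ennreal_ofReal]
    simp_rw [← fun j => ofReal_integral_eq_lintegral_ofReal (hg j) (hnn j)]
    exact hs.tsum_ofReal_ne_top
  have h2 := ae_lt_top' (AEMeasurable.tsum
    fun j => (hg j).aemeasurable.ennreal_ofReal) h1
  filter_upwards [h2, ae_all_iff.2 hnn] with a ha hnna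
  have h3 := ENNReal.summable_toReal ha.ne
  refine h3.congr fun j => ?_
  rw [ENNReal.toReal_ofReal (hnna j)]

theorem integrable_tsum_of_summable_integral {g : ℕ → α → ℝ} (hg : ∀ j, Integrable (g j) P)
    (hnn : ∀ j, 0 ≤ᵐ[P] g j) (hs : Summable fun j => ∫ a, g j a ∂P) :
    Integrable (fun a => ∑' j, g j a) P ∧ ∫ a, ∑' j, g j a ∂P = ∑' j, ∫ a, g j a ∂P := by
  have hnorm : Summable fun j => ∫ a, ‖g j a‖ ∂P := by
    refine hs.congr fun j => integral_congr_ae ?_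
    filter_upwards [hnn j] with a ha
    rw [Real.norm_of_nonneg ha]
  have hae := ae_summable_of_summable_integral hg hnn hs
  have hmeas : AEStronglyMeasurable (fun a => ∑' j, g j a) P := by
    refine aestronglyMeasurable_of_tendsto_ae atTop
      (f := fun (N : ℕ) a => ∑ j ∈ Finset.range N, g j a)
      (fun N => Finset.aestronglyMeasurable_fun_sum _ fun j _ => (hg j).1) ?_
    filter_upwards [hae] with a ha using ha.hasSum.tendsto_sum_nat
  refine ⟨⟨hmeas, ?_⟩, (integral_tsum_of_summable_integral_norm hg hnorm).symm⟩
  rw [hasFiniteIntegral_iff_norm]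
  have h1 : ∫⁻ a, ENNReal.ofReal ‖∑' j, g j a‖ ∂P ≤ ∫⁻ a, ∑' j, ENNReal.ofReal (g j a) ∂P := by
    refine lintegral_mono_ae ?_
    filter_upwards [hae, ae_all_iff.2 hnn] with a ha hnna
    rw [Real.norm_of_nonneg (tsum_nonneg hnna), ENNReal.ofReal_tsum_of_nonneg hnna ha]
  refine h1.trans_lt ?_
  rw [lintegral_tsum fun j => (hg j).aemeasurable.ennreal_ofReal]
  simp_rw [← fun j => ofReal_integral_eq_lintegral_ofReal (hg j) (hnn j)]
  exact hs.tsum_ofReal_lt_top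

end Series

/-- Since `|e^{ia} - e^{ib}| ≤ |a - b|`, an `L¹` approximation that is uniform in `n` approximates
characteristic functions uniformly in `n`. -/
theorem norm_charFun_map_sub_le {Ω : Type*} [MeasurableSpace Ω] {μ : Measure Ω}
    [IsProbabilityMeasure μ] {A B : Ω → ℝ} (hA : AEMeasurable A μ) (hB : AEMeasurable B μ)
    (hAB : Integrable (fun ω => A ω - B ω) μ) (t : ℝ) :
    ‖charFun (μ.map A) t - charFun (μ.map B) t‖ ≤ |t| * ∫ ω, |A ω - B ω| ∂μ := by
  have hint : ∀ {C : Ω → ℝ}, AEMeasurable C μ →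
      Integrable (fun ω => Complex.exp (t * C ω * Complex.I)) μ := by
    intro C hC
    refine Integrable.of_bound (C := 1) ?_ (.of_forall fun ω => ?_)
    · exact (by fun_prop : Continuous fun x : ℝ => Complex.exp (t * x * Complex.I))
        |>.comp_aestronglyMeasurable hC.aestronglyMeasurable
    · rw [← Complex.ofReal_mul, Complex.norm_exp_ofReal_mul_I]
  rw [charFun_apply_real, charFun_apply_real, integral_map hA (by fun_prop),
    integral_map hB (by fun_prop), ← integral_sub (hint hA) (hint hB), ← integral_const_mul]
  refine (norm_integral_le_integral_norm _).trans (integral_mono_of_nonneg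
    (.of_forall fun _ => norm_nonneg _) (hAB.abs.const_mul _) (.of_forall fun ω => ?_))
  have h1 : Complex.exp (t * A ω * Complex.I) - Complex.exp (t * B ω * Complex.I) =
      Complex.exp ((t * B ω : ℝ) * Complex.I) *
        (Complex.exp (Complex.I * (t * (A ω - B ω) : ℝ)) - 1) := by
    rw [mul_sub, ← Complex.exp_add, mul_one]
    push_cast
    congr 2
    ring
  simp only
  rw [h1, norm_mul, Complex.norm_exp_ofReal_mul_I, one_mul, ← abs_mul]
  exact Real.norm_exp_I_mul_ofReal_sub_one_le

/-! ### Coordinates of random elements of `ℓ²` and normalized i.i.d. sums. -/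

section Synth

variable {α : Type*} [MeasurableSpace α] {P : Measure α} {X : ℕ → α → ℝ}

theorem norm_toLp_sq {g : α → ℝ} (hg : MemLp g 2 P) : ‖hg.toLp g‖ ^ 2 = ∫ a, g a ^ 2 ∂P := by
  rw [← real_inner_self_eq_norm_sq, L2.inner_def]
  refine integral_congr_ae ?_
  filter_upwards [hg.coeFn_toLp] with a ha
  rw [ha]; simp [sq]

theorem inner_toLp {g g' : α → ℝ} (hg : MemLp g 2 P) (hg' : MemLp g' 2 P) :
    inner ℝ (hg.toLp g) (hg'.toLp g') = ∫ a, g a * g' a ∂P := by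
  rw [L2.inner_def]
  refine integral_congr_ae ?_
  filter_upwards [hg.coeFn_toLp, hg'.coeFn_toLp] with a ha ha'
  rw [ha, ha']; simp [mul_comm]

theorem summable_l2_mul {u : ℕ → ℝ} (hu : Summable fun j => u j ^ 2) (v : l2) :
    Summable fun j => v j * u j := by
  have h := summable_norm_smul (x := u) (by simpa using hu) v
  exact h.of_norm

/-- The partial sums converge in `L²`, hence almost everywhere along a subsequence, while the
pointwise series converges because `∑ X_j²` is almost everywhere finite. The class in `L²` is
thereby represented by a function that can be evaluated at the sample points. -/
theorem synth_toLp_ae_eq (hX : ∀ j, MemLp (X j) 2 P)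
    (hs : Summable fun j => ∫ a, X j a ^ 2 ∂P)
    (hs' : Summable fun j => ‖(hX j).toLp (X j)‖ ^ 2) (v : l2) :
    synth (fun j => (hX j).toLp (X j)) hs' v =ᵐ[P] fun a => ∑' j, v j * X j a := by
  have hae := ae_summable_of_summable_integral (fun j => (hX j).integrable_sq)
    (fun j => .of_forall fun a => sq_nonneg (X j a)) hs
  have h1 := tendstoInMeasure_of_tendsto_Lp (hasSum_synth hs' v).tendsto_sum_nat
  obtain ⟨ns, hns, hlim⟩ := h1.exists_seq_tendsto_ae
  have h2 : ∀ᵐ a ∂P, ∀ N : ℕ, (∑ j ∈ Finset.range N, v j • (hX j).toLp (X j) : Lp ℝ 2 P) a =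
      ∑ j ∈ Finset.range N, v j * X j a := by
    rw [ae_all_iff]
    intro N
    have h3 : (∑ j ∈ Finset.range N, v j • (hX j).toLp (X j) : Lp ℝ 2 P) =
        (memLp_finsetSum (Finset.range N) fun j _ => (hX j).const_mul (v j)).toLp
          (fun a => ∑ j ∈ Finset.range N, v j * X j a) := by
      induction N with
      | zero => 
        simp only [Finset.range_zero, Finset.sum_empty]
        rfl
      | succ N ih =>
        rw [Finset.sum_range_succ, ih]
        rw [← MemLp.toLp_const_smul, ← MemLp.toLp_add]
        congr 1
        ext a
        simp [Finset.sum_range_succ]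
    rw [h3]
    exact MemLp.coeFn_toLp _
  filter_upwards [hae, hlim, h2] with a ha hla h2a
  have h4 := (summable_l2_mul ha v).hasSum.tendsto_sum_nat.comp hns.tendsto_atTop
  refine tendsto_nhds_unique ?_ h4
  refine hla.congr fun n => ?_
  rw [h2a]; rfl

end Synth

/-- The normalized sum `n^{-1/2} ∑_{i < n} g(D_i)`. -/
noncomputable def normSum {α Ω : Type*} (D : ℕ → Ω → α) (n : ℕ) (g : α → ℝ) (ω : Ω) : ℝ :=
  (√(n : ℝ))⁻¹ * ∑ i ∈ Finset.range n, g (D i ω)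

section IID

variable {α Ω : Type*} [MeasurableSpace α] [MeasurableSpace Ω] {P : Measure α}
  {μ : Measure Ω} {D : ℕ → Ω → α}

theorem memLp_comp_of_hasLaw {Y : Ω → α} (hY : HasLaw Y P μ) {g : α → ℝ} {p : ℝ≥0∞}
    (hg : MemLp g p P) : MemLp (fun ω => g (Y ω)) p μ := by
  rw [← hY.map_eq] at hg
  exact hg.comp_of_map hY.aemeasurable

theorem aemeasurable_comp_of_hasLaw {Y : Ω → α} (hY : HasLaw Y P μ) {β : Type*}
    [MeasurableSpace β] {g : α → β}
    (hg : AEMeasurable g P) : AEMeasurable (fun ω => g (Y ω)) μ := by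
  rw [← hY.map_eq] at hg
  exact hg.comp_aemeasurable hY.aemeasurable

theorem ae_comp_of_hasLaw {Y : Ω → α} (hY : HasLaw Y P μ) {p : α → Prop}
    (hp : ∀ᵐ a ∂P, p a) : ∀ᵐ ω ∂μ, p (Y ω) := by
  rw [← hY.map_eq] at hp
  exact ae_of_ae_map hY.aemeasurable hp

/-- As `g` is only almost everywhere measurable, independence is obtained for a measurable
representative and carried over through the common law. -/
theorem iIndepFun_comp_ae (hD : ∀ i, HasLaw (D i) P μ)
    (hind : iIndepFun D μ)
    {g : α → ℝ} (hg : AEMeasurable g P) : iIndepFun (fun i ω => g (D i ω)) μ := by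
  have h1 : iIndepFun (fun i ω => hg.mk g (D i ω)) μ :=
    hind.comp (fun _ => hg.mk g) fun _ => hg.measurable_mk
  refine h1.congr fun i => ?_
  exact ae_comp_of_hasLaw (hD i) hg.ae_eq_mk.symm

theorem memLp_normSum (hD : ∀ i, HasLaw (D i) P μ) {g : α → ℝ} {p : ℝ≥0∞} (hg : MemLp g p P)
    (n : ℕ) : MemLp (normSum D n g) p μ :=
  (memLp_finsetSum _ fun i _ => memLp_comp_of_hasLaw (hD i) hg).const_mul _

theorem aemeasurable_normSum (hD : ∀ i, HasLaw (D i) P μ) {g : α → ℝ} (hg : AEMeasurable g P)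
    (n : ℕ) : AEMeasurable (normSum D n g) μ :=
  (Finset.aemeasurable_fun_sum _ fun i _ => aemeasurable_comp_of_hasLaw (hD i) hg).const_mul _

theorem integral_normSum_sq [IsProbabilityMeasure μ] [IsProbabilityMeasure P] (hD : ∀ i, HasLaw (D i) P μ)
    (hind : iIndepFun D μ) {g : α → ℝ} (hg : MemLp g 2 P) (h0 : ∫ a, g a ∂P = 0) {n : ℕ}
    (hn : n ≠ 0) : ∫ ω, normSum D n g ω ^ 2 ∂μ = ∫ a, g a ^ 2 ∂P := by
  have hgD : ∀ i, MemLp (fun ω => g (D i ω)) 2 μ := fun i => memLp_comp_of_hasLaw (hD i) hg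
  have h0D : ∀ i, ∫ ω, g (D i ω) ∂μ = 0 := fun i => by
    rw [← h0]; exact (hD i).integral_comp hg.1
  have hvar : ∀ i, variance (fun ω => g (D i ω)) μ = ∫ a, g a ^ 2 ∂P := fun i => by
    rw [variance_of_integral_eq_zero (hgD i).aemeasurable (h0D i)]
    exact (hD i).integral_comp (f := fun a => g a ^ 2) hg.integrable_sq.1
  have hsum := IndepFun.variance_sum (s := Finset.range n) (fun i _ => hgD i)
    fun i _ j _ hij => (iIndepFun_comp_ae hD hind hg.aemeasurable).indepFun hij
  rw [variance_of_integral_eq_zero, Finset.sum_congr rfl fun i _ => hvar i] at hsum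
  · simp only [normSum, mul_pow, integral_const_mul]
    simp only [Finset.sum_apply, Finset.sum_const, Finset.card_range, nsmul_eq_mul] at hsum
    rw [hsum, inv_pow, Real.sq_sqrt (Nat.cast_nonneg n), inv_mul_cancel_left₀]
    exact_mod_cast hn
  · exact (memLp_finsetSum' _ fun i _ => hgD i).aemeasurable
  · simp only [Finset.sum_apply]
    rw [integral_finsetSum _ fun i _ => (hgD i).integrable one_le_two]
    simp [h0D]

theorem integral_normSum_sq_le [IsProbabilityMeasure μ] [IsProbabilityMeasure P] (hD : ∀ i, HasLaw (D i) P μ)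
    (hind : iIndepFun D μ) {g : α → ℝ} (hg : MemLp g 2 P) (h0 : ∫ a, g a ∂P = 0) (n : ℕ) :
    ∫ ω, normSum D n g ω ^ 2 ∂μ ≤ ∫ a, g a ^ 2 ∂P := by
  -- For `n = 0` the normalized sum is zero, so only the inequality holds.
  rcases eq_or_ne n 0 with rfl | hn
  · simpa [normSum] using integral_nonneg fun a => sq_nonneg (g a)
  · exact (integral_normSum_sq hD hind hg h0 hn).le

end IID

section Bessel

variable {α Ω : Type*} {X : ℕ → α → ℝ} {D : ℕ → Ω → α} {ω : Ω}

theorem hasSum_inner_l2 (e v : l2) : HasSum (fun j => e j * v j) (inner ℝ e v) := by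
  have := lp.hasSum_inner (𝕜 := ℝ) e v
  simpa [mul_comm] using this

/-- The normalized sum `V` of the sample vectors lies in `ℓ²`; it has coordinates `normSum D n (X j)
ω`, and its inner product with `e k` is the normalized sum of `⟨e k, X⟩`. The claim is the assumed
Bessel inequality for `V`. -/
theorem summable_sq_normSum_and_bessel {e : ℕ → l2}
    (he : ∀ (v : l2) (K : ℕ), ∑ k ∈ Finset.range K, inner ℝ (e k) v ^ 2 ≤ ‖v‖ ^ 2)
    (hX : ∀ i, Summable fun j => X j (D i ω) ^ 2) (n : ℕ) :
    (Summable fun j => normSum D n (X j) ω ^ 2) ∧ ∀ K : ℕ,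
      ∑ k ∈ Finset.range K, normSum D n (fun a => ∑' j, e k j * X j a) ω ^ 2 ≤
        ∑' j, normSum D n (X j) ω ^ 2 := by
  let u : ℕ → l2 := fun i => ⟨fun j => X j (D i ω), by
    refine memℓp_gen ?_
    simpa using hX i⟩
  let V : l2 := (√(n : ℝ))⁻¹ • ∑ i ∈ Finset.range n, u i
  have hV : ∀ j, V j = normSum D n (X j) ω := by
    intro j
    have h1 : (∑ i ∈ Finset.range n, u i : l2) j = ∑ i ∈ Finset.range n, u i j := by
      rw [AddSubgroup.val_finsetSum]
      exact Finset.sum_apply _ _ _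
    change (√(n : ℝ))⁻¹ * (∑ i ∈ Finset.range n, u i : l2) j = _
    rw [h1]
    rfl
  have h2 := hasSum_sq_l2 V
  simp only [hV] at h2
  refine ⟨h2.summable, fun K => ?_⟩
  rw [h2.tsum_eq]
  refine le_trans (le_of_eq (Finset.sum_congr rfl fun k _ => ?_)) (he V K)
  congr 1
  rw [inner_smul_right, inner_sum]
  simp only [normSum]
  congr 1
  refine Finset.sum_congr rfl fun i _ => ?_
  exact (hasSum_inner_l2 (e k) (u i)).tsum_eq

end Bessel

/-! ### Finite-dimensional central limit theorem and chi-square laws. -/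

/-- Convergence in distribution sees only the law of the limit, so the Gaussian limit may be
exchanged for one built from the given `χ`, on another probability space. -/
theorem tendstoInDistribution_of_map_limit_eq {ι E Ω₁ Ω₂ : Type*} {Ω : ι → Type*}
    [∀ i, MeasurableSpace (Ω i)] {μ : ∀ i, Measure (Ω i)} [∀ i, IsProbabilityMeasure (μ i)]
    [MeasurableSpace Ω₁] [MeasurableSpace Ω₂] {μ₁ : Measure Ω₁} [IsProbabilityMeasure μ₁]
    {μ₂ : Measure Ω₂} [IsProbabilityMeasure μ₂] [TopologicalSpace E] [MeasurableSpace E]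
    [OpensMeasurableSpace E] {X : ∀ i, Ω i → E} {l : Filter ι} {Z₁ : Ω₁ → E} {Z₂ : Ω₂ → E}
    (h : TendstoInDistribution X l Z₁ μ μ₁) (hZ₂ : AEMeasurable Z₂ μ₂)
    (heq : μ₁.map Z₁ = μ₂.map Z₂) : TendstoInDistribution X l Z₂ μ μ₂ := by
  refine ⟨h.forall_aemeasurable, hZ₂, ?_⟩
  have h1 := h.tendsto
  have h2 : (⟨μ₂.map Z₂, Measure.isProbabilityMeasure_map hZ₂⟩ : ProbabilityMeasure E) =
      ⟨μ₁.map Z₁, Measure.isProbabilityMeasure_map h.aemeasurable_limit⟩ := Subtype.ext heq.symm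
  rwa [h2]

theorem gaussianReal_map_sq {c : ℝ} (hc : 0 ≤ c) :
    (gaussianReal 0 c.toNNReal).map (fun x => x ^ 2) = chiSquareOne.map (fun x => c * x) := by
  have h1 : gaussianReal 0 c.toNNReal = (gaussianReal 0 1).map (√c * ·) := by
    rw [gaussianReal_map_const_mul]
    congr 1
    · simp
    · ext; simp [Real.sq_sqrt hc, hc]
  rw [h1, chiSquareOne, Measure.map_map (by fun_prop) (by fun_prop),
    Measure.map_map (by fun_prop) (by fun_prop)]
  congr 1
  ext x
  simp [mul_pow, Real.sq_sqrt hc]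

theorem integral_chiSquareOne : ∫ x, x ∂chiSquareOne = 1 := by
  rw [chiSquareOne, integral_map (by fun_prop) (by fun_prop)]
  have h := variance_id_gaussianReal (μ := 0) (v := 1)
  rw [variance_of_integral_eq_zero (by fun_prop) (by simp [integral_id_gaussianReal])] at h
  simpa using h

theorem integrable_chiSquareOne : Integrable (fun x => x) chiSquareOne := by
  rw [chiSquareOne, integrable_map_measure (by fun_prop) (by fun_prop)]
  exact (memLp_id_gaussianReal' (μ := 0) (v := 1) 2 (by simp)).integrable_sq

theorem chiSquareOne_nonneg : ∀ᵐ x ∂chiSquareOne, 0 ≤ x := by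
  rw [chiSquareOne, ae_map_iff (by fun_prop) measurableSet_Ici]
  exact .of_forall fun x => sq_nonneg x

theorem pi_gaussianReal_map_sum_sq {Ω' : Type*} [MeasurableSpace Ω'] {μ' : Measure Ω'}
    [IsProbabilityMeasure μ'] {χ : ℕ → Ω' → ℝ} (hχ : ∀ j, HasLaw (χ j) chiSquareOne μ')
    (hχi : iIndepFun χ μ') {lam : ℕ → ℝ} (hlam : ∀ k, 0 ≤ lam k) (K : ℕ) :
    ((Measure.pi fun k : Fin K => gaussianReal 0 (lam k).toNNReal).map
      (WithLp.toLp 2 : (Fin K → ℝ) → EuclideanSpace ℝ (Fin K))).map (fun x => ∑ k, x k ^ 2) =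
      μ'.map (fun ω => ∑ k : Fin K, lam k * χ k ω) := by
  have hpr : ∀ k : Fin K, IsProbabilityMeasure
      ((gaussianReal 0 (lam k).toNNReal).map (fun x => x ^ 2)) := fun k =>
    Measure.isProbabilityMeasure_map (by fun_prop)
  have h1 : (Measure.pi fun k : Fin K => gaussianReal 0 (lam k).toNNReal).map
      (fun x k => x k ^ 2) = μ'.map (fun ω (k : Fin K) => lam k * χ k ω) := by
    rw [Measure.pi_map_pi (f := fun (_ : Fin K) (x : ℝ) => x ^ 2) (fun k => by fun_prop)]
    have h2 : iIndepFun (fun (k : Fin K) ω => lam k * χ k ω) μ' :=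
      (hχi.precomp Fin.val_injective).comp (fun k x => lam k * x) fun k => by fun_prop
    have hm : ∀ k : Fin K, AEMeasurable (fun ω => lam k * χ k ω) μ' := fun k =>
      (hχ k).aemeasurable.const_mul _
    rw [(iIndepFun_iff_map_fun_eq_pi_map hm).1 h2]
    congr 1
    ext1 k
    rw [gaussianReal_map_sq (hlam k), ← (hχ k).map_eq,
      AEMeasurable.map_map_of_aemeasurable (by fun_prop) (hχ k).aemeasurable]
    rfl
  rw [Measure.map_map (by fun_prop) (by fun_prop)]
  have h3 := congrArg (fun ν : Measure (Fin K → ℝ) => ν.map fun x => ∑ k, x k) h1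
  rw [Measure.map_map (by fun_prop) (by fun_prop), AEMeasurable.map_map_of_aemeasurable
    (by fun_prop) (aemeasurable_pi_lambda _ fun (k : Fin K) =>
      (hχ k).aemeasurable.const_mul (lam k))] at h3
  exact h3

/-- Cramér–Wold: the characteristic function of the vector at `t` is that of the scalar normalized
sum of `g = ∑ t_k y_k` at `1`. The scalar central limit theorem applies with variance `∑ t_k²
lam_k`, as the `y_k` are uncorrelated; the map to the sum of squares is continuous. -/
theorem tendstoInDistribution_sum_sq_normSum {α Ω : Type*} [MeasurableSpace α]
    [MeasurableSpace Ω] {P : Measure α} [IsProbabilityMeasure P] {μ : Measure Ω}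
    [IsProbabilityMeasure μ] {D : ℕ → Ω → α} (hD : ∀ i, HasLaw (D i) P μ) (hind : iIndepFun D μ)
    {Ω' : Type*} [MeasurableSpace Ω'] {μ' : Measure Ω'}
    [IsProbabilityMeasure μ'] {χ : ℕ → Ω' → ℝ} (hχ : ∀ j, HasLaw (χ j) chiSquareOne μ')
    (hχi : iIndepFun χ μ') {lam : ℕ → ℝ} (hlam : ∀ k, 0 ≤ lam k) {y : ℕ → α → ℝ}
    (hy : ∀ k, MemLp (y k) 2 P) (hy0 : ∀ k, ∫ a, y k a ∂P = 0)
    (hyy : ∀ k l, ∫ a, y k a * y l a ∂P = if k = l then lam k else 0) (K : ℕ) :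
    TendstoInDistribution (fun n ω => ∑ k : Fin K, normSum D n (y k) ω ^ 2) atTop
      (fun ω => ∑ k : Fin K, lam k * χ k ω) (fun _ => μ) μ' := by
  set G : Measure (EuclideanSpace ℝ (Fin K)) :=
    (Measure.pi fun k : Fin K => gaussianReal 0 (lam k).toNNReal).map (WithLp.toLp 2) with hG
  have hGp : IsProbabilityMeasure G := Measure.isProbabilityMeasure_map (by fun_prop)
  have hvec : ∀ n, AEMeasurable
      (fun ω => WithLp.toLp 2 fun k : Fin K => normSum D n (y k) ω) μ := fun n =>
    (by fun_prop : Measurable (WithLp.toLp 2 : (Fin K → ℝ) → EuclideanSpace ℝ (Fin K)))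
      |>.comp_aemeasurable
      (aemeasurable_pi_lambda _ fun k => aemeasurable_normSum hD (hy k).aemeasurable n)
  have hclt : TendstoInDistribution
      (fun n ω => WithLp.toLp 2 fun k : Fin K => normSum D n (y k) ω) atTop
      (id : EuclideanSpace ℝ (Fin K) → _) (fun _ => μ) G := by
    refine ⟨hvec, aemeasurable_id, ?_⟩
    refine ProbabilityMeasure.tendsto_iff_tendsto_charFun.2 fun t => ?_
    simp only [ProbabilityMeasure.coe_mk, Measure.map_id]
    set g : α → ℝ := fun a => ∑ k : Fin K, t k * y k a with hg
    have hgm : MemLp g 2 P := memLp_finsetSum _ fun k _ => (hy k).const_mul _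
    have hg0 : ∫ a, g a ∂P = 0 := by
      simp only [hg]
      rw [integral_finsetSum _ fun (k : Fin K) _ =>
        ((hy k).const_mul (t k)).integrable one_le_two]
      simp [integral_const_mul, hy0]
    have hg2 : ∫ a, g a ^ 2 ∂P = ∑ k : Fin K, t k ^ 2 * lam k := by
      have h1 : ∀ a, g a ^ 2 = ∑ k : Fin K, ∑ l : Fin K, t k * t l * (y k a * y l a) := by
        intro a
        simp only [hg, sq, Finset.sum_mul_sum]
        exact Finset.sum_congr rfl fun k _ => Finset.sum_congr rfl fun l _ => by ring
      have hi : ∀ k l : Fin K, Integrable (fun a => t k * t l * (y k a * y l a)) P :=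
        fun k l => ((hy k).integrable_mul (hy l)).const_mul _
      simp only [h1]
      rw [integral_finsetSum _ fun k _ => integrable_finsetSum _ fun l _ => hi k l]
      refine Finset.sum_congr rfl fun k _ => ?_
      rw [integral_finsetSum _ fun l _ => hi k l]
      simp only [integral_const_mul, hyy, Fin.val_inj, mul_ite, mul_zero]
      simp [sq]
    have h1 : ∀ n, charFun (μ.map fun ω => (WithLp.toLp 2 fun k : Fin K => normSum D n (y k) ω :
        EuclideanSpace ℝ (Fin K))) t = charFun (μ.map (normSum D n g)) 1 := by
      intro n
      rw [charFun_apply, charFun_apply_real, integral_map (hvec n) (by fun_prop),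
        integral_map (aemeasurable_normSum hD hgm.aemeasurable n) (by fun_prop)]
      refine integral_congr_ae (.of_forall fun ω => ?_)
      simp only [PiLp.inner_apply, Complex.ofReal_one, one_mul]
      congr 3
      simp only [normSum, hg]
      rw [Finset.sum_comm, Finset.mul_sum]
      refine Finset.sum_congr rfl fun k _ => ?_
      rw [← Finset.mul_sum]
      simp
      ring
    simp only [h1]
    set v : ℝ := ∑ k : Fin K, t k ^ 2 * lam k with hv
    have hv0 : 0 ≤ v := Finset.sum_nonneg fun k _ => mul_nonneg (sq_nonneg _) (hlam k)
    have h2 : charFun G t = charFun (gaussianReal 0 v.toNNReal) 1 := by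
      rw [hG, charFun_pi, charFun_gaussianReal]
      simp only [charFun_gaussianReal]
      rw [← Complex.exp_sum]
      congr 1
      simp only [Complex.ofReal_zero, mul_zero, zero_mul, zero_sub, Complex.ofReal_one, one_pow,
        mul_one, Real.coe_toNNReal _ (hlam _), Real.coe_toNNReal _ hv0]
      rw [hv, Finset.sum_neg_distrib, ← Finset.sum_div]
      push_cast
      congr 2
      exact Finset.sum_congr rfl fun k _ => mul_comm _ _
    rw [h2]
    have hident : ∀ i, IdentDistrib (fun ω => g (D i ω)) (fun ω => g (D 0 ω)) μ μ := fun i =>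
      ⟨aemeasurable_comp_of_hasLaw (hD i) hgm.aemeasurable,
        aemeasurable_comp_of_hasLaw (hD 0) hgm.aemeasurable, by
        have h4 : ∀ i, μ.map (fun ω => g (D i ω)) = P.map g := fun i => by
          rw [← (hD i).map_eq, AEMeasurable.map_map_of_aemeasurable
            ((hD i).map_eq.symm ▸ hgm.aemeasurable) (hD i).aemeasurable]
          rfl
        rw [h4, h4]⟩
    have hE : ∫ ω, g (D 0 ω) ∂μ = 0 := by
      rw [← hg0]; exact (hD 0).integral_comp hgm.1
    have hV : variance (fun ω => g (D 0 ω)) μ = v := by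
      rw [variance_of_integral_eq_zero (aemeasurable_comp_of_hasLaw (hD 0) hgm.aemeasurable) hE,
        ← hg2]
      exact (hD 0).integral_comp (f := fun a => g a ^ 2) hgm.integrable_sq.1
    have h3 := tendstoInDistribution_inv_sqrt_mul_sum_sub (Y := id)
      (P' := gaussianReal 0 v.toNNReal) (X := fun i ω => g (D i ω)) (P := μ)
      ⟨aemeasurable_id, by rw [Measure.map_id, hV]⟩ (memLp_comp_of_hasLaw (hD 0) hgm)
      (iIndepFun_comp_ae hD hind hgm.aemeasurable) hident
    have h5 := (ProbabilityMeasure.tendsto_iff_tendsto_charFun.1 h3.tendsto) 1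
    simp only [ProbabilityMeasure.coe_mk, Measure.map_id, hE, mul_zero, sub_zero] at h5
    exact h5
  have h6 := hclt.continuous_comp (g := fun x : EuclideanSpace ℝ (Fin K) => ∑ k, x k ^ 2)
    (by fun_prop)
  refine tendstoInDistribution_of_map_limit_eq h6
    (Finset.aemeasurable_fun_sum _ fun k _ => (hχ k).aemeasurable.const_mul _) ?_
  rw [Function.comp_id, ← pi_gaussianReal_map_sum_sq hχ hχi hlam]

/-! ### Weighted chi-square series and the limit theorem in `ℓ²`. -/

section WeightedChiSquare

variable {Ω' : Type*} [MeasurableSpace Ω'] {μ' : Measure Ω'} {χ : ℕ → Ω' → ℝ}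

theorem integrable_mul_chiSquare (hχ : ∀ j, HasLaw (χ j) chiSquareOne μ') (c : ℝ) (k : ℕ) :
    Integrable (fun ω => c * χ k ω) μ' := by
  refine Integrable.const_mul ?_ c
  have h := integrable_chiSquareOne
  rw [← (hχ k).map_eq, integrable_map_measure (by fun_prop) (hχ k).aemeasurable] at h
  exact h

theorem integral_mul_chiSquare (hχ : ∀ j, HasLaw (χ j) chiSquareOne μ') (c : ℝ) (k : ℕ) :
    ∫ ω, c * χ k ω ∂μ' = c := by
  rw [integral_const_mul, (hχ k).integral_eq, integral_chiSquareOne, mul_one]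

theorem mul_chiSquare_nonneg (hχ : ∀ j, HasLaw (χ j) chiSquareOne μ') {c : ℝ} (hc : 0 ≤ c)
    (k : ℕ) : 0 ≤ᵐ[μ'] fun ω => c * χ k ω := by
  filter_upwards [ae_comp_of_hasLaw (hχ k) chiSquareOne_nonneg] with ω hω
  exact mul_nonneg hc hω

variable {lam : ℕ → ℝ}

theorem ae_summable_mul_chiSquare (hχ : ∀ j, HasLaw (χ j) chiSquareOne μ')
    (hlam : ∀ k, 0 ≤ lam k) (hs : Summable lam) :
    ∀ᵐ ω ∂μ', Summable fun j => lam j * χ j ω :=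
  ae_summable_of_summable_integral (fun j => integrable_mul_chiSquare hχ (lam j) j)
    (fun j => mul_chiSquare_nonneg hχ (hlam j) j) (by simpa [integral_mul_chiSquare hχ] using hs)

theorem integrable_tsum_mul_chiSquare (hχ : ∀ j, HasLaw (χ j) chiSquareOne μ')
    (hlam : ∀ k, 0 ≤ lam k) (hs : Summable lam) :
    Integrable (fun ω => ∑' j, lam j * χ j ω) μ' ∧
      ∫ ω, ∑' j, lam j * χ j ω ∂μ' = ∑' j, lam j := by
  have h := integrable_tsum_of_summable_integral
    (fun j => integrable_mul_chiSquare hχ (lam j) j)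
    (fun j => mul_chiSquare_nonneg hχ (hlam j) j) (by simpa [integral_mul_chiSquare hχ] using hs)
  simpa only [integral_mul_chiSquare hχ] using h

/-- The remainder of the series is nonnegative, so its `L¹` norm is its expectation, and each `χ_k`
has mean `1`. -/
theorem integral_abs_tsum_sub_sum_chiSquare (hχ : ∀ j, HasLaw (χ j) chiSquareOne μ')
    (hlam : ∀ k, 0 ≤ lam k) (hs : Summable lam) (K : ℕ) :
    ∫ ω, |∑' j, lam j * χ j ω - ∑ k : Fin K, lam k * χ k ω| ∂μ' =
      ∑' j, lam j - ∑ k ∈ Finset.range K, lam k := by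
  have h := integrable_tsum_mul_chiSquare hχ hlam hs
  have hnn := ae_all_iff.2 fun j => mul_chiSquare_nonneg hχ (hlam j) j
  have h1 : ∀ᵐ ω ∂μ', |∑' j, lam j * χ j ω - ∑ k : Fin K, lam k * χ k ω| =
      ∑' j, lam j * χ j ω - ∑ k : Fin K, lam k * χ k ω := by
    filter_upwards [ae_summable_mul_chiSquare hχ hlam hs, hnn] with ω hω hnω
    refine abs_of_nonneg (sub_nonneg.2 ?_)
    rw [Fin.sum_univ_eq_sum_range (fun k => lam k * χ k ω)]
    exact hω.sum_le_tsum _ fun j _ => hnω j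
  rw [integral_congr_ae h1, integral_sub h.1
    (integrable_finsetSum _ fun k _ => integrable_mul_chiSquare hχ _ _), h.2,
    integral_finsetSum _ fun (k : Fin K) _ => integrable_mul_chiSquare hχ _ _,
    ← Fin.sum_univ_eq_sum_range]
  simp only [integral_mul_chiSquare hχ]

end WeightedChiSquare

/-- The squared norm of the normalized sum of i.i.d. centred random elements of `ℓ²` (given by
their coordinates) converges in distribution to a weighted sum of chi-square variables. -/
theorem exists_tendstoInDistribution_weightedChiSquare {α Ω : Type*} [MeasurableSpace α]
    [MeasurableSpace Ω] {P : Measure α} [IsProbabilityMeasure P] {μ : Measure Ω}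
    [IsProbabilityMeasure μ] {D : ℕ → Ω → α} (hD : ∀ i, HasLaw (D i) P μ) (hind : iIndepFun D μ)
    {Ω' : Type*} [MeasurableSpace Ω'] {μ' : Measure Ω'}
    [IsProbabilityMeasure μ'] {χ : ℕ → Ω' → ℝ} (hχ : ∀ j, HasLaw (χ j) chiSquareOne μ')
    (hχi : iIndepFun χ μ') {X : ℕ → α → ℝ} (hX : ∀ j, MemLp (X j) 2 P)
    (hX0 : ∀ j, ∫ a, X j a ∂P = 0) (hs : Summable fun j => ∫ a, X j a ^ 2 ∂P)
    {m : ℕ → ℕ} (hm : Tendsto m atTop atTop) :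
    ∃ lam : ℕ → ℝ, IsOrderedEigenvalues (fun i j => covariance (X i) (X j) P) lam ∧
      Summable lam ∧ (∀ᵐ ω ∂μ', Summable fun j => lam j * χ j ω) ∧
      TendstoInDistribution (fun n ω => ∑ j ∈ Finset.range (m n), normSum D n (X j) ω ^ 2) atTop
        (fun ω => ∑' j, lam j * χ j ω) (fun _ => μ) μ' := by
  set x : ℕ → Lp ℝ 2 P := fun j => (hX j).toLp (X j) with hx
  have hs' : Summable fun j => ‖x j‖ ^ 2 := by simpa only [hx, norm_toLp_sq] using hs
  obtain ⟨lam, e, hord, hlam, htr, hbess, horth⟩ := exists_orderedEigenvalues_gram hs'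
  -- Centred coordinates have their `L²(P)` inner products as covariances.
  have hgram : (fun i j => inner ℝ (x i) (x j)) = fun i j => covariance (X i) (X j) P := by
    ext i j
    rw [hx, inner_toLp, covariance_eq_sub (hX i) (hX j), hX0, zero_mul, sub_zero]
    rfl
  rw [hgram] at hord
  simp only [hx, norm_toLp_sq] at htr
  set T : ℝ := ∑' j, ∫ a, X j a ^ 2 ∂P with hT
  -- The coordinate of `X` along the `k`-th eigenvector.
  set y : ℕ → α → ℝ := fun k a => ∑' j, e k j * X j a with hy
  have hyae : ∀ k, synth x hs' (e k) =ᵐ[P] y k := fun k => synth_toLp_ae_eq hX hs hs' (e k)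
  have hymem : ∀ k, MemLp (y k) 2 P := fun k => (Lp.memLp _).ae_eq (hyae k)
  have hyy : ∀ k l, ∫ a, y k a * y l a ∂P = if k = l then lam k else 0 := by
    intro k l
    rw [← horth k l, L2.inner_def]
    refine integral_congr_ae ?_
    filter_upwards [hyae k, hyae l] with a h1 h2
    rw [h1, h2]; simp [mul_comm]
  have hy0 : ∀ k, ∫ a, y k a ∂P = 0 := by
    intro k
    have h1 : MemLp (fun _ : α => (1 : ℝ)) 2 P := memLp_const 1
    have h2 : inner ℝ (h1.toLp _) (synth x hs' (e k)) = 0 := by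
      have h3 := (hasSum_synth hs' (e k)).mapL (innerSL ℝ (h1.toLp _))
      refine h3.unique ?_
      convert hasSum_zero with j
      rw [innerSL_apply_apply, inner_smul_right, hx, inner_toLp]
      simp [hX0]
    rw [L2.inner_def] at h2
    rw [← h2]
    refine integral_congr_ae ?_
    filter_upwards [hyae k, h1.coeFn_toLp] with a h3 h4
    rw [h3, h4]; simp
  refine ⟨lam, hord, htr.summable, ae_summable_mul_chiSquare hχ hlam htr.summable, ?_⟩
  have hXD : ∀ᵐ ω ∂μ, ∀ i, Summable fun j => X j (D i ω) ^ 2 := ae_all_iff.2 fun i =>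
    ae_comp_of_hasLaw (hD i) (ae_summable_of_summable_integral (fun j => (hX j).integrable_sq)
      (fun j => .of_forall fun a => sq_nonneg (X j a)) hs)
  -- The full squared norm is the intermediary between the cutoff after `m n` original coordinates
  -- and the cutoff after `K` eigencoordinates. Both cutoffs lie below it, so both `L¹` errors are
  -- differences of expectations, that is, tails of series with sum `T`.
  set Q : ℕ → Ω → ℝ := fun n ω => ∑' j, normSum D n (X j) ω ^ 2 with hQ
  have hZint : ∀ n j, Integrable (fun ω => normSum D n (X j) ω ^ 2) μ := fun n j =>
    (memLp_normSum hD (hX j) n).integrable_sq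
  have hZ2 : ∀ n, n ≠ 0 → ∀ j, ∫ ω, normSum D n (X j) ω ^ 2 ∂μ = ∫ a, X j a ^ 2 ∂P :=
    fun n hn j => integral_normSum_sq hD hind (hX j) (hX0 j) hn
  have hQint : ∀ n, n ≠ 0 → Integrable (Q n) μ ∧ ∫ ω, Q n ω ∂μ = T := by
    intro n hn
    have h := integrable_tsum_of_summable_integral (hZint n)
      (fun j => .of_forall fun ω => sq_nonneg (normSum D n (X j) ω)) (by simpa only [hZ2 n hn])
    simpa only [hZ2 n hn] using h
  have hQm : ∀ n, n ≠ 0 → ∀ m : ℕ,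
      ∫ ω, |∑ j ∈ Finset.range m, normSum D n (X j) ω ^ 2 - Q n ω| ∂μ =
        T - ∑ j ∈ Finset.range m, ∫ a, X j a ^ 2 ∂P := by
    intro n hn m
    have h1 : ∀ᵐ ω ∂μ, |∑ j ∈ Finset.range m, normSum D n (X j) ω ^ 2 - Q n ω| =
        Q n ω - ∑ j ∈ Finset.range m, normSum D n (X j) ω ^ 2 := by
      filter_upwards [hXD] with ω hω
      rw [abs_sub_comm, abs_of_nonneg]
      exact sub_nonneg.2 ((summable_sq_normSum_and_bessel hbess hω n).1.sum_le_tsum _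
        fun j _ => sq_nonneg _)
    rw [integral_congr_ae h1, integral_sub (hQint n hn).1
      (integrable_finsetSum _ fun j _ => hZint n j), (hQint n hn).2,
      integral_finsetSum _ fun j _ => hZint n j]
    simp only [hZ2 n hn]
  have hyint : ∀ n k, Integrable (fun ω => normSum D n (y k) ω ^ 2) μ := fun n k =>
    (memLp_normSum hD (hymem k) n).integrable_sq
  have hQK : ∀ n, n ≠ 0 → ∀ K : ℕ,
      ∫ ω, |Q n ω - ∑ k : Fin K, normSum D n (y k) ω ^ 2| ∂μ =
        T - ∑ k ∈ Finset.range K, lam k := by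
    intro n hn K
    have h1 : ∀ᵐ ω ∂μ, |Q n ω - ∑ k : Fin K, normSum D n (y k) ω ^ 2| =
        Q n ω - ∑ k ∈ Finset.range K, normSum D n (y k) ω ^ 2 := by
      filter_upwards [hXD] with ω hω
      rw [Fin.sum_univ_eq_sum_range (fun k => normSum D n (y k) ω ^ 2), abs_of_nonneg]
      exact sub_nonneg.2 ((summable_sq_normSum_and_bessel hbess hω n).2 K)
    rw [integral_congr_ae h1, integral_sub (hQint n hn).1
      (integrable_finsetSum _ fun j _ => hyint n j), (hQint n hn).2,
      integral_finsetSum _ fun j _ => hyint n j]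
    congr 1
    refine Finset.sum_congr rfl fun k _ => ?_
    rw [integral_normSum_sq hD hind (hymem k) (hy0 k) hn]
    simpa [sq] using hyy k k
  have hlim := integrable_tsum_mul_chiSquare hχ hlam htr.summable
  have hmeas : ∀ n, AEMeasurable
      (fun ω => ∑ j ∈ Finset.range (m n), normSum D n (X j) ω ^ 2) μ := fun n =>
    (integrable_finsetSum _ fun j _ => hZint n j).aemeasurable
  refine ⟨hmeas, hlim.1.aemeasurable, ?_⟩
  refine ProbabilityMeasure.tendsto_iff_tendsto_charFun.2 fun t => ?_
  simp only [ProbabilityMeasure.coe_mk]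
  rw [Metric.tendsto_atTop]
  intro ε hε
  -- Four errors of `ε / 4`: two truncations of the statistic, one of the limit series (each at most
  -- `|t| * δ`), and the central limit theorem for fixed `K`. The `+ 1` covers `t = 0`.
  set δ : ℝ := ε / (4 * (|t| + 1)) with hδ
  have hδ0 : 0 < δ := by positivity
  obtain ⟨K, hK⟩ : ∃ K : ℕ, T - ∑ k ∈ Finset.range K, lam k < δ := by
    have h1 := htr.tendsto_sum_nat.eventually (lt_mem_nhds (sub_lt_self T hδ0))
    obtain ⟨K, hK⟩ := h1.exists
    exact ⟨K, by linarith⟩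
  have hmT : ∀ᶠ n in atTop, T - ∑ j ∈ Finset.range (m n), ∫ a, X j a ^ 2 ∂P < δ := by
    have h1 := (hs.hasSum.tendsto_sum_nat.comp hm).eventually (lt_mem_nhds (sub_lt_self T hδ0))
    filter_upwards [h1] with n hn
    simp only [Function.comp_apply] at hn
    linarith
  have hfin := (ProbabilityMeasure.tendsto_iff_tendsto_charFun.1
    (tendstoInDistribution_sum_sq_normSum hD hind hχ hχi hlam hymem hy0 hyy K).tendsto) t
  simp only [ProbabilityMeasure.coe_mk] at hfin
  have hfin' := (Metric.tendsto_nhds.1 hfin) (ε / 4) (by positivity)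
  obtain ⟨N, hN⟩ := eventually_atTop.1 (hmT.and (hfin'.and (eventually_ne_atTop 0)))
  refine ⟨N, fun n hn => ?_⟩
  obtain ⟨h1, h2, h3⟩ := hN n hn
  have hKint : Integrable (fun ω => ∑ k : Fin K, normSum D n (y k) ω ^ 2) μ :=
    integrable_finsetSum _ fun k _ => hyint n k
  have hKχ : Integrable (fun ω => ∑ k : Fin K, lam k * χ k ω) μ' :=
    integrable_finsetSum _ fun k _ => integrable_mul_chiSquare hχ _ _
  have b1 := norm_charFun_map_sub_le (hmeas n) (hQint n h3).1.aemeasurable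
    ((integrable_finsetSum _ fun j _ => hZint n j).sub (hQint n h3).1) t
  have b2 := norm_charFun_map_sub_le (hQint n h3).1.aemeasurable hKint.aemeasurable
    ((hQint n h3).1.sub hKint) t
  have b3 := norm_charFun_map_sub_le hlim.1.aemeasurable hKχ.aemeasurable (hlim.1.sub hKχ) t
  rw [hQm n h3] at b1
  rw [hQK n h3] at b2
  rw [integral_abs_tsum_sub_sum_chiSquare hχ hlam htr.summable, htr.tsum_eq] at b3
  have ht : |t| * δ < ε / 4 := by
    rw [hδ, mul_div_assoc', div_lt_div_iff₀ (by positivity) (by positivity)]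
    nlinarith [abs_nonneg t]
  have c1 : |t| * (T - ∑ j ∈ Finset.range (m n), ∫ a, X j a ^ 2 ∂P) ≤ |t| * δ :=
    mul_le_mul_of_nonneg_left h1.le (abs_nonneg t)
  have c2 : |t| * (T - ∑ k ∈ Finset.range K, lam k) ≤ |t| * δ :=
    mul_le_mul_of_nonneg_left hK.le (abs_nonneg t)
  rw [← dist_eq_norm] at b1 b2 b3
  rw [dist_comm] at b3
  refine lt_of_le_of_lt (dist_triangle4 _ _ _ _)
    (lt_of_lt_of_le (add_lt_add_of_le_of_lt
      (add_le_add (b1.trans (c1.trans ht.le)) (b2.trans (c2.trans ht.le)))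
      (lt_of_le_of_lt (dist_triangle _ _ _)
        (add_lt_add_of_lt_of_le h2 (b3.trans (c2.trans ht.le))))) (by linarith))

/-! ### Calculus of stochastic orders. -/

section Tightness

variable {Ω : Type*} [MeasurableSpace Ω] {μ : Measure Ω} {X Y : ℕ → Ω → ℝ}

theorem tendstoInMeasure_zero_iff :
    TendstoInMeasure μ X atTop (fun _ => 0) ↔
      ∀ ε, 0 < ε → Tendsto (fun n => μ {ω | ε ≤ |X n ω|}) atTop (𝓝 0) := by
  simp [tendstoInMeasure_iff_norm]

theorem isBigOProb_one_of_integral_le [IsProbabilityMeasure μ] (hX : ∀ n, Integrable (X n) μ)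
    (hnn : ∀ n ω, 0 ≤ X n ω)
    {C : ℝ} (hC : ∀ n, ∫ ω, X n ω ∂μ ≤ C) : IsBigOProb μ X fun _ => 1 := by
  intro ε hε
  have hC0 : 0 ≤ C := (integral_nonneg (hnn 0)).trans (hC 0)
  -- Markov's inequality; `C + 1` rather than `C` keeps the threshold positive when `C = 0`.
  refine ⟨(C + 1) / ε, 0, fun n _ => ?_⟩
  have h1 := mul_meas_ge_le_integral_of_nonneg (.of_forall (hnn n)) (hX n) ((C + 1) / ε)
  have h2 : μ.real {ω | (C + 1) / ε ≤ X n ω} ≤ ε := by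
    have h3 := h1.trans (hC n)
    rw [div_mul_eq_mul_div, div_le_iff₀ hε] at h3
    nlinarith
  rw [ENNReal.le_ofReal_iff_toReal_le (measure_ne_top _ _) hε.le]
  refine le_trans (measureReal_mono ?_) h2
  intro ω hω
  simp only [Set.mem_ofPred_eq, _root_.mul_one, Real.norm_of_nonneg (hnn n ω)] at hω
  exact hω.le

theorem IsBigOProb.mul_one (hX : IsBigOProb μ X fun _ => 1) (hY : IsBigOProb μ Y fun _ => 1) :
    IsBigOProb μ (fun n ω => X n ω * Y n ω) fun _ => 1 := by
  intro ε hε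
  obtain ⟨C₁, N₁, h₁⟩ := hX (ε / 2) (by positivity)
  obtain ⟨C₂, N₂, h₂⟩ := hY (ε / 2) (by positivity)
  refine ⟨max C₁ 0 * max C₂ 0, max N₁ N₂, fun n hn => ?_⟩
  have h : {ω | max C₁ 0 * max C₂ 0 * 1 < ‖X n ω * Y n ω‖} ⊆
      {ω | C₁ * 1 < ‖X n ω‖} ∪ {ω | C₂ * 1 < ‖Y n ω‖} := by
    intro ω hω
    by_contra! hcon
    simp only [Set.mem_union, Set.mem_ofPred_eq, not_or, not_lt, _root_.mul_one] at hcon hω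
    rw [norm_mul] at hω
    exact absurd (mul_le_mul (hcon.1.trans (le_max_left _ 0)) (hcon.2.trans (le_max_left _ 0))
      (norm_nonneg _) (le_max_right _ _)) (not_le.2 hω)
  calc _ ≤ _ := measure_mono h
    _ ≤ _ := measure_union_le _ _
    _ ≤ ENNReal.ofReal (ε / 2) + ENNReal.ofReal (ε / 2) :=
        add_le_add (h₁ n ((le_max_left _ _).trans hn)) (h₂ n ((le_max_right _ _).trans hn))
    _ = ENNReal.ofReal ε := by
        rw [← ENNReal.ofReal_add (by positivity) (by positivity), add_halves]

theorem IsBigOProb.mul_tendstoInMeasure_zero (hX : IsBigOProb μ X fun _ => 1)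
    (hY : TendstoInMeasure μ Y atTop fun _ => 0) :
    TendstoInMeasure μ (fun n ω => X n ω * Y n ω) atTop fun _ => 0 := by
  rw [tendstoInMeasure_zero_iff] at hY ⊢
  intro ε hε
  rw [ENNReal.tendsto_atTop_zero]
  intro η hη
  obtain ⟨η', hη'0, hη'⟩ : ∃ η' : ℝ, 0 < η' ∧ ENNReal.ofReal η' ≤ η / 2 := by
    obtain ⟨r, hr0, hr⟩ := ENNReal.lt_iff_exists_nnreal_btwn.1 (ENNReal.half_pos hη.ne')
    exact ⟨r, by exact_mod_cast hr0, by simpa using hr.le⟩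
  obtain ⟨C, N, hC⟩ := hX η' hη'0
  obtain ⟨N', hN'⟩ := ENNReal.tendsto_atTop_zero.1 (hY (ε / max C 1) (by positivity)) (η / 2)
    (ENNReal.half_pos hη.ne')
  refine ⟨max N N', fun n hn => ?_⟩
  have h : {ω | ε ≤ |X n ω * Y n ω|} ⊆
      {ω | C * 1 < ‖X n ω‖} ∪ {ω | ε / max C 1 ≤ |Y n ω|} := by
    intro ω hω
    by_contra! hcon
    simp only [Set.mem_union, Set.mem_ofPred_eq, not_or, not_lt, not_le, _root_.mul_one,
      Real.norm_eq_abs] at hcon hω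
    rw [abs_mul] at hω
    have h1 : |X n ω| ≤ max C 1 := hcon.1.trans (le_max_left _ _)
    have h2 := (lt_div_iff₀ (by positivity)).1 hcon.2
    nlinarith [abs_nonneg (Y n ω)]
  calc _ ≤ _ := measure_mono h
    _ ≤ _ := measure_union_le _ _
    _ ≤ η / 2 + η / 2 := add_le_add ((hC n ((le_max_left _ _).trans hn)).trans hη')
        (hN' n ((le_max_right _ _).trans hn))
    _ = η := ENNReal.add_halves η

theorem tendstoInMeasure_zero_of_tendsto {a : ℕ → ℝ} (ha : Tendsto a atTop (𝓝 0)) :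
    TendstoInMeasure μ (fun n _ => a n) atTop fun _ => 0 := by
  rw [tendstoInMeasure_zero_iff]
  intro ε hε
  have h := ha.abs.eventually (gt_mem_nhds (by simpa using hε : |(0 : ℝ)| < ε))
  refine tendsto_const_nhds.congr' ?_
  filter_upwards [h] with n hn
  simp [not_le.2 hn]

theorem TendstoInMeasure.add_zero (hX : TendstoInMeasure μ X atTop fun _ => 0)
    (hY : TendstoInMeasure μ Y atTop fun _ => 0) :
    TendstoInMeasure μ (fun n ω => X n ω + Y n ω) atTop fun _ => 0 := by
  rw [tendstoInMeasure_zero_iff] at hX hY ⊢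
  intro ε hε
  have h := (hX (ε / 2) (by positivity)).add (hY (ε / 2) (by positivity))
  rw [_root_.add_zero] at h
  refine tendsto_of_tendsto_of_tendsto_of_le_of_le tendsto_const_nhds h (fun _ => zero_le)
    fun n => ?_
  refine (measure_mono fun ω (hω : ε ≤ _) => ?_).trans (measure_union_le _ _)
  by_contra! hcon
  simp only [Set.mem_union, Set.mem_ofPred_eq, not_or, not_le] at hcon
  linarith [abs_add_le (X n ω) (Y n ω)]

/-- The sets `B n` absorb the event that the estimator leaves the neighbourhood where the Taylor
expansion is valid. -/
theorem tendstoInMeasure_zero_of_abs_le (hY : TendstoInMeasure μ Y atTop fun _ => 0)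
    {B : ℕ → Set Ω} (hB : Tendsto (fun n => μ (B n)) atTop (𝓝 0))
    (h : ∀ᶠ n in atTop, ∀ᵐ ω ∂μ, ω ∉ B n → |X n ω| ≤ Y n ω) :
    TendstoInMeasure μ X atTop fun _ => 0 := by
  rw [tendstoInMeasure_zero_iff] at hY ⊢
  intro ε hε
  have h1 := hB.add (hY ε hε)
  rw [_root_.add_zero] at h1
  refine tendsto_of_tendsto_of_tendsto_of_le_of_le' tendsto_const_nhds h1
    (.of_forall fun _ => zero_le) ?_
  filter_upwards [h] with n hn
  refine le_trans (measure_mono_ae ?_) (measure_union_le _ _)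
  filter_upwards [hn] with ω hω
  intro (h2 : ε ≤ |X n ω|)
  by_cases h3 : ω ∈ B n
  · exact Or.inl h3
  · exact Or.inr (h2.trans ((hω h3).trans (le_abs_self _)))

theorem tendstoInMeasure_zero_sqrt (hX : TendstoInMeasure μ X atTop fun _ => 0) :
    TendstoInMeasure μ (fun n ω => √(X n ω)) atTop fun _ => 0 := by
  rw [tendstoInMeasure_zero_iff] at hX ⊢
  intro ε hε
  refine tendsto_of_tendsto_of_tendsto_of_le_of_le tendsto_const_nhds (hX (ε ^ 2) (by positivity))
    (fun _ => zero_le) fun n => measure_mono fun ω (hω : ε ≤ _) => ?_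
  rw [abs_of_nonneg (Real.sqrt_nonneg _)] at hω
  exact ((Real.le_sqrt' hε).1 hω).trans (le_abs_self _)

theorem IsBigOProb.sqrt_one (hX : IsBigOProb μ X fun _ => 1) :
    IsBigOProb μ (fun n ω => √(X n ω)) fun _ => 1 := by
  intro ε hε
  obtain ⟨C, N, h⟩ := hX ε hε
  refine ⟨√C, N, fun n hn => le_trans (measure_mono ?_) (h n hn)⟩
  intro ω hω
  simp only [Set.mem_ofPred_eq, _root_.mul_one, Real.norm_of_nonneg (Real.sqrt_nonneg _)] at hω ⊢
  have h2 : C < X n ω := by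
    by_contra! hcon
    exact absurd (Real.sqrt_le_sqrt hcon) (not_le.2 hω)
  exact h2.trans_le (le_abs_self _)

end Tightness

/-! ### Taylor bounds from partial derivatives alone. -/

section Taylor

variable {k : ℕ} {u : Vec k → ℝ} {θ₀ θ : Vec k}

theorem norm_le_norm_of_abs_coord_le {x y : Vec k} (h : ∀ l, |x l| ≤ |y l|) : ‖x‖ ≤ ‖y‖ := by
  rw [EuclideanSpace.norm_eq, EuclideanSpace.norm_eq]
  refine Real.sqrt_le_sqrt (Finset.sum_le_sum fun l _ => ?_)
  simp only [Real.norm_eq_abs]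
  exact pow_le_pow_left₀ (abs_nonneg _) (h l) 2

/-- A function whose partial derivatives on a ball deviate from constants `v` by at most `c` is
close to the affine function with slope `v`. -/
theorem abs_sub_sub_sum_le (hd : ∀ ξ ∈ Metric.closedBall θ₀ ‖θ - θ₀‖, ∀ l : Fin k,
      LineDifferentiableAt ℝ u ξ (EuclideanSpace.single l 1))
    (v : Fin k → ℝ) {c : ℝ}
    (hc : ∀ ξ ∈ Metric.closedBall θ₀ ‖θ - θ₀‖, ∀ l, |partialD l u ξ - v l| ≤ c) :
    |u θ - u θ₀ - ∑ l, v l * (θ l - θ₀ l)| ≤ c * ∑ l, |θ l - θ₀ l| := by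
  classical
  -- The path from `θ₀` to `θ` changes one coordinate at a time, since only derivatives along the
  -- axes are available.
  let p : Finset (Fin k) → Vec k := fun s => WithLp.toLp 2 fun l => if l ∈ s then θ l else θ₀ l
  suffices H : ∀ s : Finset (Fin k),
      |u (p s) - u θ₀ - ∑ l ∈ s, v l * (θ l - θ₀ l)| ≤ c * ∑ l ∈ s, |θ l - θ₀ l| by
    have h1 : p Finset.univ = θ := by ext l; simp [p]
    simpa [h1] using H Finset.univ
  intro s
  induction s using Finset.induction_on with
  | empty =>
    have h1 : p ∅ = θ₀ := by ext l; simp [p]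
    simp [h1]
  | insert a s ha ih =>
    -- Subtracting the linear term leaves a function whose derivative is the deviation bounded by
    -- `c`, ready for the mean value inequality.
    set w : ℝ → ℝ := fun t => u (p s + t • EuclideanSpace.single a 1) - v a * t with hw
    -- No coordinate on the path is farther from that of `θ₀` than the coordinate of `θ`, so the
    -- path stays in the ball.
    have hmem : ∀ t ∈ Set.uIcc 0 (θ a - θ₀ a),
        p s + t • EuclideanSpace.single a (1 : ℝ) ∈ Metric.closedBall θ₀ ‖θ - θ₀‖ := by
      intro t ht
      rw [mem_closedBall_iff_norm]
      refine norm_le_norm_of_abs_coord_le fun l => ?_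
      by_cases hl : l = a
      · subst hl
        have h1 := Set.abs_sub_left_of_mem_uIcc ht
        simpa [p, ha] using h1
      · by_cases hls : l ∈ s <;> simp [p, hl, hls]
    have hderiv : ∀ t ∈ Set.uIcc 0 (θ a - θ₀ a), HasDerivAt w
        (partialD a u (p s + t • EuclideanSpace.single a 1) - v a) t := by
      intro t ht
      have h1 := (hd _ (hmem t ht) a).hasLineDerivAt
      have h2 : HasDerivAt (fun t' => u (p s + t' • EuclideanSpace.single a (1 : ℝ)))
          (partialD a u (p s + t • EuclideanSpace.single a 1)) t := by
        have h3 : HasDerivAt (fun r => u ((p s + t • EuclideanSpace.single a (1 : ℝ)) +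
          r • EuclideanSpace.single a (1 : ℝ)))
          (partialD a u (p s + t • EuclideanSpace.single a 1)) (t - t) := by
          rw [sub_self]; exact h1
        have h4 := h3.comp_sub_const t t
        refine h4.congr_of_eventuallyEq (.of_forall fun r => ?_)
        simp only
        rw [add_assoc, ← add_smul, add_sub_cancel]
      have h5 := h2.sub ((hasDerivAt_id t).const_mul (v a))
      simpa [hw] using! h5
    have hmvt := Convex.norm_image_sub_le_of_norm_hasDerivWithin_le (f := w)
      (s := Set.uIcc 0 (θ a - θ₀ a)) (C := c)
      (fun t ht => (hderiv t ht).hasDerivWithinAt) (fun t ht => hc _ (hmem t ht) a)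
      (convex_uIcc _ _) Set.left_mem_uIcc Set.right_mem_uIcc
    have hp : p s + (θ a - θ₀ a) • EuclideanSpace.single a (1 : ℝ) = p (insert a s) := by
      ext l
      by_cases hl : l = a
      · subst hl; simp [p, ha]
      · simp [p, hl]
    simp only [hw, hp, zero_smul, add_zero, mul_zero, sub_zero, Real.norm_eq_abs] at hmvt
    rw [Finset.sum_insert ha, Finset.sum_insert ha, mul_add]
    refine le_trans (le_of_eq ?_) ((abs_add_le _ _).trans (add_le_add hmvt ih))
    congr 1
    ring

/-- Second order Taylor bound under mere existence of bounded second partial derivatives. -/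
theorem abs_taylor_le {U : Set (Vec k)} {b : ℝ} (hu : TwicePartiallyDifferentiableOn u U)
    (hU : Metric.closedBall θ₀ ‖θ - θ₀‖ ⊆ U)
    (hb : ∀ ξ ∈ U, ∀ j l : Fin k, |partialD j (partialD l u) ξ| ≤ b) :
    |u θ - u θ₀ - ∑ l, partialD l u θ₀ * (θ l - θ₀ l)| ≤ (k : ℝ) ^ 2 * b * ‖θ - θ₀‖ ^ 2 := by
  have hsum : ∀ ξ : Vec k, ∑ l, |ξ l - θ₀ l| ≤ k * ‖ξ - θ₀‖ := by
    intro ξ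
    refine (Finset.sum_le_card_nsmul _ _ ‖ξ - θ₀‖ fun l _ => ?_).trans (by simp)
    exact PiLp.norm_apply_le (ξ - θ₀) l
  -- In dimension `0` the hypothesis `hb` is empty and `b` may be negative.
  rcases Nat.eq_zero_or_pos k with rfl | hk
  · have : θ = θ₀ := Subsingleton.elim _ _
    simp [this]
  have hθ₀ : θ₀ ∈ U := hU (Metric.mem_closedBall_self (norm_nonneg _))
  have hb0 : 0 ≤ b := (abs_nonneg _).trans (hb θ₀ hθ₀ ⟨0, hk⟩ ⟨0, hk⟩)
  -- The first order bound is used twice: with slope `0` for each first partial derivative, then for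
  -- `u` with its slope at `θ₀`. Each use costs a factor `k` from comparing the `ℓ¹` and Euclidean
  -- norms.
  have h1 : ∀ ξ ∈ Metric.closedBall θ₀ ‖θ - θ₀‖, ∀ l,
      |partialD l u ξ - partialD l u θ₀| ≤ b * (k * ‖θ - θ₀‖) := by
    intro ξ hξ l
    have hξ' : ‖ξ - θ₀‖ ≤ ‖θ - θ₀‖ := mem_closedBall_iff_norm.1 hξ
    have hsub : Metric.closedBall θ₀ ‖ξ - θ₀‖ ⊆ U :=
      (Metric.closedBall_subset_closedBall hξ').trans hU
    have h2 := abs_sub_sub_sum_le (u := partialD l u) (θ₀ := θ₀) (θ := ξ)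
      (fun η hη j => (hu η (hsub hη) l).2 j) (fun _ => 0) (c := b)
      (fun η hη j => by simpa using hb η (hsub hη) j l)
    simp only [zero_mul, Finset.sum_const_zero, sub_zero] at h2
    refine h2.trans (mul_le_mul_of_nonneg_left ((hsum ξ).trans ?_) hb0)
    gcongr
  have h3 := abs_sub_sub_sum_le (u := u) (θ₀ := θ₀) (θ := θ) (fun η hη j => (hu η (hU hη) j).1)
    (fun l => partialD l u θ₀) h1
  refine h3.trans ((mul_le_mul_of_nonneg_left (hsum θ) (by positivity)).trans (le_of_eq ?_))
  ring

end Taylor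

/-! ### Moment bounds for instruments, errors and gradients. -/

section Moments

theorem measurable_obsW {dz dw : ℕ} : Measurable (obsW : Obs dz dw → Vec dw) :=
  measurable_snd.comp measurable_snd

theorem measurable_obsZ {dz dw : ℕ} : Measurable (obsZ : Obs dz dw → Vec dz) :=
  measurable_fst.comp measurable_snd

theorem measurable_obsY {dz dw : ℕ} : Measurable (obsY : Obs dz dw → ℝ) := measurable_fst

/-- The support carries the whole law of `W`, and there the density is at most `ηp * ν`. Moments
under `ν` therefore control moments under `P`. -/
theorem map_obsW_le {dz dw : ℕ} {P : Measure (Obs dz dw)} {ν : Vec dw → ℝ}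
    (hν : IsProbDensity ν) {f : ℕ → Vec dw → ℝ} (hb : BasisCondition P ν f) :
    ∃ η : ℝ, 0 ≤ η ∧ P.map obsW ≤ ENNReal.ofReal η • densityMeasure ν := by
  obtain ⟨pW, hpW, hmap, ηp, hη, hle⟩ := hb.density
  refine ⟨ηp, by linarith, ?_⟩
  set S := (P.map obsW).support with hS
  have hSm : MeasurableSet S := Measure.isClosed_support.measurableSet
  have h1 : (P.map obsW).restrict S = P.map obsW :=
    Measure.restrict_eq_self_of_ae_mem Measure.support_mem_ae
  rw [← h1]
  have h2 : (P.map obsW).restrict S =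
      (volume.restrict S).withDensity (fun w => ENNReal.ofReal (pW w)) := by
    conv_lhs => rw [hmap]
    exact restrict_withDensity hSm _
  rw [h2]
  calc (volume.restrict S).withDensity (fun w => ENNReal.ofReal (pW w))
      ≤ (volume.restrict S).withDensity (fun w => ENNReal.ofReal ηp * ENNReal.ofReal (ν w)) := by
        refine withDensity_mono ?_
        rw [EventuallyLE, ae_restrict_iff' hSm]
        refine .of_forall fun w hw => ?_
        rw [← ENNReal.ofReal_mul (by linarith)]
        exact ENNReal.ofReal_le_ofReal ((div_le_iff₀ (hb.pos w hw)).1 (hle w hw))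
    _ = (volume.withDensity (fun w => ENNReal.ofReal ηp * ENNReal.ofReal (ν w))).restrict S :=
        (restrict_withDensity hSm _).symm
    _ ≤ volume.withDensity (fun w => ENNReal.ofReal ηp * ENNReal.ofReal (ν w)) :=
        Measure.restrict_le_self
    _ = ENNReal.ofReal ηp • densityMeasure ν :=
        withDensity_smul _ hν.measurable.ennreal_ofReal

variable {α : Type*} [MeasurableSpace α] {P : Measure α}

theorem memLp_four_of_lintegral_le {g : α → ℝ} (hg : AEStronglyMeasurable g P) {C : ℝ}
    (h : ∫⁻ a, ‖g a‖ₑ ^ 4 ∂P ≤ ENNReal.ofReal C) : MemLp g 4 P := by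
  refine ⟨hg, ?_⟩
  rw [eLpNorm_lt_top_iff_lintegral_rpow_enorm_lt_top (by norm_num) (by norm_num)]
  refine lt_of_le_of_lt (le_trans (le_of_eq ?_) h) ENNReal.ofReal_lt_top
  refine lintegral_congr fun a => ?_
  rw [← ENNReal.rpow_natCast]
  norm_num

theorem integrable_pow_four {g : α → ℝ} (hg : MemLp g 4 P) : Integrable (fun a => g a ^ 4) P := by
  have h := hg.integrable_norm_pow (p := 4) (by norm_num)
  refine h.congr (.of_forall fun a => ?_)
  simp only [Real.norm_eq_abs]
  exact Even.pow_abs ⟨2, rfl⟩ _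

theorem integral_pow_four_le_of_lintegral_le {g : α → ℝ} (hg : AEStronglyMeasurable g P) {C : ℝ}
    (hC : 0 ≤ C) (h : ∫⁻ a, ‖g a‖ₑ ^ 4 ∂P ≤ ENNReal.ofReal C) : ∫ a, g a ^ 4 ∂P ≤ C := by
  have h1 := integrable_pow_four (memLp_four_of_lintegral_le hg h)
  rw [← ENNReal.ofReal_le_ofReal_iff hC,
    ofReal_integral_eq_lintegral_ofReal h1 (.of_forall fun a => by positivity)]
  refine le_trans (le_of_eq (lintegral_congr fun a => ?_)) h
  rw [Real.enorm_eq_ofReal_abs, ← ENNReal.ofReal_pow (abs_nonneg _), Even.pow_abs ⟨2, rfl⟩]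

theorem memLp_four_of_integrable {g : α → ℝ} (hg : AEStronglyMeasurable g P)
    (h : Integrable (fun a => g a ^ 4) P) : MemLp g 4 P := by
  refine memLp_four_of_lintegral_le hg (C := ∫ a, g a ^ 4 ∂P) (le_of_eq ?_)
  rw [ofReal_integral_eq_lintegral_ofReal h (.of_forall fun a => by positivity)]
  refine lintegral_congr fun a => ?_
  rw [Real.enorm_eq_ofReal_abs, ← ENNReal.ofReal_pow (abs_nonneg _), Even.pow_abs ⟨2, rfl⟩]

theorem MemLp.four_to_two [IsFiniteMeasure P] {g : α → ℝ} (hg : MemLp g 4 P) : MemLp g 2 P :=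
  hg.mono_exponent (by norm_num)

/-- Products of functions in `L⁴` are in `L²`. -/
theorem memLp_two_mul {a b : α → ℝ} (ha : MemLp a 4 P) (hb : MemLp b 4 P) :
    MemLp (fun x => a x * b x) 2 P := by
  have h1 : AEStronglyMeasurable (fun x => a x * b x) P := ha.1.mul hb.1
  rw [memLp_two_iff_integrable_sq h1]
  refine (((integrable_pow_four ha).add (integrable_pow_four hb)).div_const 2).mono'
    (h1.pow 2) (.of_forall fun x => ?_)
  rw [Real.norm_of_nonneg (sq_nonneg _)]
  simp only [Pi.add_apply]
  nlinarith [sq_nonneg (a x ^ 2 - b x ^ 2)]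

/-- The inequality `(ab)² ≤ (a⁴ + b⁴) / 2` suffices, because one constant bounds both fourth
moments. -/
theorem integral_mul_sq_le {a b : α → ℝ} (ha : MemLp a 4 P) (hb : MemLp b 4 P) {C : ℝ}
    (hCa : ∫ x, a x ^ 4 ∂P ≤ C) (hCb : ∫ x, b x ^ 4 ∂P ≤ C) :
    ∫ x, (a x * b x) ^ 2 ∂P ≤ C := by
  have h1 : ∫ x, (a x * b x) ^ 2 ∂P ≤ ∫ x, (a x ^ 4 + b x ^ 4) / 2 ∂P := by
    refine integral_mono (memLp_two_mul ha hb).integrable_sq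
      (((integrable_pow_four ha).add (integrable_pow_four hb)).div_const 2) fun x => ?_
    simp only
    nlinarith [sq_nonneg (a x ^ 2 - b x ^ 2)]
  rw [integral_div, integral_add (integrable_pow_four ha) (integrable_pow_four hb)] at h1
  linarith

theorem sq_integral_le [IsProbabilityMeasure P] {g : α → ℝ} (hg : MemLp g 2 P) :
    (∫ x, g x ∂P) ^ 2 ≤ ∫ x, g x ^ 2 ∂P := by
  have h := variance_nonneg g P
  rw [variance_eq_sub hg] at h
  simpa using h

theorem integral_sq_le_one_add [IsProbabilityMeasure P] {g : α → ℝ} (hg : MemLp g 4 P) {C : ℝ}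
    (hC : ∫ x, g x ^ 4 ∂P ≤ C) : ∫ x, g x ^ 2 ∂P ≤ 1 + C := by
  have h1 : ∫ x, g x ^ 2 ∂P ≤ ∫ x, (1 + g x ^ 4) ∂P := by
    refine integral_mono (MemLp.four_to_two hg).integrable_sq
      ((integrable_const _).add (integrable_pow_four hg)) fun x => ?_
    simp only
    nlinarith [sq_nonneg (g x ^ 2 - 1), sq_nonneg (g x)]
  rw [integral_add (integrable_const _) (integrable_pow_four hg)] at h1
  simp at h1
  linarith

end Moments

section Instruments

variable {dz dw k : ℕ} {P : Measure (Obs dz dw)}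

theorem exists_moment_bound_basis {ν : Vec dw → ℝ} (hν : IsProbDensity ν)
    {f : ℕ → Vec dw → ℝ} (hf : IsOrthonormalBasisL2 ν f) (hb : BasisCondition P ν f) :
    ∃ C : ℝ, 0 ≤ C ∧ ∀ j, MemLp (fun x => f j (obsW x)) 4 P ∧ ∫ x, f j (obsW x) ^ 4 ∂P ≤ C := by
  obtain ⟨η, hη, hle⟩ := map_obsW_le hν hb
  obtain ⟨ηf, hηf, hmom⟩ := hb.moments
  have hC : 0 ≤ η * ηf := mul_nonneg hη (by linarith)
  refine ⟨η * ηf, hC, fun j => ?_⟩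
  have hmeas : AEStronglyMeasurable (fun x => f j (obsW x)) P :=
    ((hf.1 j).comp measurable_obsW).aestronglyMeasurable
  have h1 : ∫⁻ x, ‖f j (obsW x)‖ₑ ^ 4 ∂P ≤ ENNReal.ofReal (η * ηf) := by
    have hfm := hf.1 j
    calc ∫⁻ x, ‖f j (obsW x)‖ₑ ^ 4 ∂P = ∫⁻ w, ‖f j w‖ₑ ^ 4 ∂(P.map obsW) := by
          rw [lintegral_map (by fun_prop) measurable_obsW]
      _ ≤ ∫⁻ w, ‖f j w‖ₑ ^ 4 ∂(ENNReal.ofReal η • densityMeasure ν) := lintegral_mono' hle le_rfl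
      _ = ENNReal.ofReal η * ∫⁻ w, ‖f j w‖ₑ ^ 4 ∂(densityMeasure ν) := by
          rw [lintegral_smul_measure, smul_eq_mul]
      _ ≤ ENNReal.ofReal η * ENNReal.ofReal ηf := by gcongr; exact hmom j
      _ = _ := (ENNReal.ofReal_mul hη).symm
  exact ⟨memLp_four_of_lintegral_le hmeas h1, integral_pow_four_le_of_lintegral_le hmeas hC h1⟩

/-- A factor depending on `W` alone comes out of the conditional expectation given `W`. This centres
the first part of the score. -/
theorem integral_err_mul_eq_zero [IsProbabilityMeasure P] {sol : Vec dz → ℝ} (hm : IsModel P sol) {g : Vec dw → ℝ}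
    (hg : Measurable g) (hint : Integrable (fun x => err sol x * g (obsW x)) P) :
    ∫ x, err sol x * g (obsW x) ∂P = 0 := by
  have hle : sigmaW dz dw ≤ (inferInstance : MeasurableSpace (Obs dz dw)) :=
    measurable_obsW.comap_le
  have hgs : StronglyMeasurable[sigmaW dz dw] fun x : Obs dz dw => g (obsW x) := by
    refine Measurable.stronglyMeasurable ?_
    exact hg.comp (comap_measurable obsW)
  have h1 := condExp_mul_of_stronglyMeasurable_right hgs hint hm.integrable_err
  rw [← integral_condExp hle, integral_eq_zero_of_ae]
  filter_upwards [h1, hm.condExp_err] with x h2 h3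
  change (P[fun x => err sol x * g (obsW x) | sigmaW dz dw]) x = 0
  have h2' : (P[fun x => err sol x * g (obsW x) | sigmaW dz dw]) x = _ := h2
  rw [h2']
  simp [h3]

/-- The partial derivative is a pointwise limit of measurable difference quotients with steps `1 /
(n + 1)`. -/
theorem measurable_partialD_section {φ : Vec dz → Vec k → ℝ} {Θ : Set (Vec k)} {θ₀ : Vec k}
    (hθ₀ : θ₀ ∈ interior Θ) (hφ : SmoothParametrization P φ Θ θ₀) (l : Fin k) :
    Measurable fun z => partialD l (φ z) θ₀ := by
  have hsec : ∀ θ, Measurable fun z => φ z θ := fun θ =>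
    hφ.measurable.comp (measurable_id.prodMk measurable_const)
  refine measurable_of_tendsto_metrizable (f := fun (n : ℕ) z => ((1 : ℝ) / (n + 1))⁻¹ •
    (φ z (θ₀ + ((1 : ℝ) / (n + 1)) • EuclideanSpace.single l (1 : ℝ)) - φ z θ₀))
    (fun n => ?_) ?_
  · have h1 := hsec (θ₀ + ((1 : ℝ) / (n + 1)) • EuclideanSpace.single l (1 : ℝ))
    have h2 := hsec θ₀
    fun_prop
  rw [tendsto_pi_nhds]
  intro z
  have h1 := (hφ.differentiable z θ₀ hθ₀ l).1.hasLineDerivAt.tendsto_slope_zero_right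
  refine h1.comp (tendsto_nhdsWithin_iff.2 ⟨tendsto_one_div_add_atTop_nhds_zero_nat, ?_⟩)
  exact .of_forall fun n => by simp; positivity

end Instruments

/-! ### Effect of estimating the parameter. -/

/-- The deterministic bound for the effect of the parameter estimator on the sample moments: for
`p_i = ∑ g_il d_l + r_i` with `|r_i| ≤ b_i ‖d‖²`. -/
theorem sum_sq_moment_remainder_le {k n m : ℕ} (hn : n ≠ 0) {τ : ℕ → ℝ} (hτ : ∀ j, 0 ≤ τ j)
    (F : ℕ → ℕ → ℝ) (U p b : ℕ → ℝ) (g h : Fin k → ℕ → ℝ) (c : Fin k → ℕ → ℝ) (d : Vec k)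
    (hr : ∀ i, |p i - ∑ l, g l i * d l| ≤ b i * ‖d‖ ^ 2) :
    ∑ j ∈ Finset.range m, (√(τ j) * ((√(n : ℝ))⁻¹ * ∑ i ∈ Finset.range n, (U i - p i) * F j i) -
        √(τ j) * ((√(n : ℝ))⁻¹ * ∑ i ∈ Finset.range n, (U i * F j i - ∑ l, c l j * h l i))) ^ 2 ≤
      3 * ((n : ℝ)⁻¹ * ((√(n : ℝ) * ‖d‖) ^ 4 * (((n : ℝ)⁻¹ * ∑ i ∈ Finset.range n, b i ^ 2) *
          ((n : ℝ)⁻¹ * ∑ i ∈ Finset.range n, ∑ j ∈ Finset.range m, τ j * F j i ^ 2))) +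
        (n : ℝ)⁻¹ * ((√(n : ℝ) * ‖d‖) ^ 2 * ∑ j ∈ Finset.range m, τ j * ∑ l,
          ((√(n : ℝ))⁻¹ * ∑ i ∈ Finset.range n, (g l i * F j i - c l j)) ^ 2) +
        (∑ j ∈ Finset.range m, τ j * ∑ l, c l j ^ 2) *
          ‖√(n : ℝ) • d - (√(n : ℝ))⁻¹ • ∑ i ∈ Finset.range n,
            (WithLp.toLp 2 fun l => h l i : Vec k)‖ ^ 2) := by
  set s : ℝ := √(n : ℝ) with hs
  have hn0 : (0 : ℝ) < n := by exact_mod_cast Nat.pos_of_ne_zero hn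
  have hs0 : 0 < s := Real.sqrt_pos.2 hn0
  have hs2 : s ^ 2 = n := Real.sq_sqrt hn0.le
  set r : ℕ → ℝ := fun i => p i - ∑ l, g l i * d l with hrdef
  set δ : Vec k := s • d - s⁻¹ • ∑ i ∈ Finset.range n, (WithLp.toLp 2 fun l => h l i : Vec k)
    with hδ
  have hδl : ∀ l, δ l = s * d l - s⁻¹ * ∑ i ∈ Finset.range n, h l i := by
    intro l
    simp [hδ]
  set R : ℕ → ℝ := fun j => s⁻¹ * ∑ i ∈ Finset.range n, r i * F j i with hR
  set M : Fin k → ℕ → ℝ := fun l j => s⁻¹ * ∑ i ∈ Finset.range n, (g l i * F j i - c l j) with hM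
  -- Three sources of error: the Taylor remainder `R`, the fluctuation `M` of `g F` about its mean
  -- `c`, and the error `δ` of the linear representation. The terms `√n ∑ c d` coming from `M` and
  -- from `δ` cancel.
  have hdecomp : ∀ j, s⁻¹ * ∑ i ∈ Finset.range n, (U i - p i) * F j i -
      s⁻¹ * ∑ i ∈ Finset.range n, (U i * F j i - ∑ l, c l j * h l i) =
      -(R j + ∑ l, d l * M l j + ∑ l, c l j * δ l) := by
    intro j
    have e1 : ∑ l, d l * M l j =
        s⁻¹ * (∑ i ∈ Finset.range n, (∑ l, g l i * d l) * F j i) - s * ∑ l, c l j * d l := by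
      have e3 : ∀ l, d l * M l j = s⁻¹ * (∑ i ∈ Finset.range n, g l i * d l * F j i) -
          s * (c l j * d l) := by
        intro l
        simp only [hM, Finset.sum_sub_distrib, Finset.sum_const, Finset.card_range, nsmul_eq_mul]
        rw [mul_sub, mul_sub, ← hs2]
        congr 1
        · rw [mul_left_comm, Finset.mul_sum]
          congr 1
          exact Finset.sum_congr rfl fun i _ => by ring
        · field_simp
      simp only [e3, Finset.sum_sub_distrib, ← Finset.mul_sum]
      rw [Finset.sum_comm]
      simp only [Finset.sum_mul]
    have e2 : ∑ l, c l j * δ l = s * ∑ l, c l j * d l -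
        s⁻¹ * ∑ i ∈ Finset.range n, ∑ l, c l j * h l i := by
      have e3 : ∀ l, c l j * δ l = s * (c l j * d l) -
          s⁻¹ * ∑ i ∈ Finset.range n, c l j * h l i := by
        intro l
        rw [hδl, mul_sub, ← Finset.mul_sum]
        ring
      simp only [e3, Finset.sum_sub_distrib]
      rw [← Finset.mul_sum, ← Finset.mul_sum, Finset.sum_comm (s := Finset.univ)]
    rw [e1, e2]
    simp only [hR, hrdef, sub_mul, Finset.sum_sub_distrib, mul_sub]
    ring
  have hcs : ∀ (x y : Fin k → ℝ), (∑ l, x l * y l) ^ 2 ≤ (∑ l, x l ^ 2) * ∑ l, y l ^ 2 :=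
    fun x y => Finset.sum_mul_sq_le_sq_mul_sq _ _ _
  have hd2 : ∑ l, d l ^ 2 = ‖d‖ ^ 2 := (EuclideanSpace.real_norm_sq_eq d).symm
  have hδ2 : ∑ l, δ l ^ 2 = ‖δ‖ ^ 2 := (EuclideanSpace.real_norm_sq_eq δ).symm
  have hRsq : ∀ j, R j ^ 2 ≤ ‖d‖ ^ 4 * ((n : ℝ)⁻¹ * ((∑ i ∈ Finset.range n, b i ^ 2) *
      ∑ i ∈ Finset.range n, F j i ^ 2)) := by
    intro j
    simp only [hR, mul_pow, inv_pow, hs2]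
    have h1 := Finset.sum_mul_sq_le_sq_mul_sq (Finset.range n) r (F j)
    have h2 : ∑ i ∈ Finset.range n, r i ^ 2 ≤ ‖d‖ ^ 4 * ∑ i ∈ Finset.range n, b i ^ 2 := by
      rw [Finset.mul_sum]
      refine Finset.sum_le_sum fun i _ => ?_
      have h3 := pow_le_pow_left₀ (abs_nonneg _) (hr i) 2
      rw [sq_abs] at h3
      refine h3.trans (le_of_eq ?_)
      ring
    have h4 : 0 ≤ ∑ i ∈ Finset.range n, F j i ^ 2 := Finset.sum_nonneg fun i _ => sq_nonneg _
    calc (n : ℝ)⁻¹ * (∑ i ∈ Finset.range n, r i * F j i) ^ 2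
        ≤ (n : ℝ)⁻¹ * ((‖d‖ ^ 4 * ∑ i ∈ Finset.range n, b i ^ 2) *
            ∑ i ∈ Finset.range n, F j i ^ 2) := by
          gcongr
          exact h1.trans (mul_le_mul_of_nonneg_right h2 h4)
      _ = _ := by ring
  -- The factor `3` is from `(x + y + z)² ≤ 3 (x² + y² + z²)`; Cauchy–Schwarz over `l` treats the
  -- last two terms.
  calc _ ≤ ∑ j ∈ Finset.range m, τ j * (3 * (‖d‖ ^ 4 * ((n : ℝ)⁻¹ *
          ((∑ i ∈ Finset.range n, b i ^ 2) * ∑ i ∈ Finset.range n, F j i ^ 2)) +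
          ‖d‖ ^ 2 * ∑ l, M l j ^ 2 + (∑ l, c l j ^ 2) * ‖δ‖ ^ 2)) := by
        refine Finset.sum_le_sum fun j _ => ?_
        rw [← mul_sub, mul_pow, Real.sq_sqrt (hτ j), hdecomp, neg_sq]
        refine mul_le_mul_of_nonneg_left ?_ (hτ j)
        have h1 := hcs (fun l => d l) fun l => M l j
        have h2 := hcs (fun l => c l j) fun l => δ l
        rw [hd2] at h1
        rw [hδ2] at h2
        have h3 := hRsq j
        nlinarith [sq_nonneg (R j - ∑ l, d l * M l j), sq_nonneg (R j - ∑ l, c l j * δ l),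
          sq_nonneg (∑ l, d l * M l j - ∑ l, c l j * δ l)]
    _ = _ := by
        have e1 : ∑ i ∈ Finset.range n, ∑ j ∈ Finset.range m, τ j * F j i ^ 2 =
            ∑ j ∈ Finset.range m, τ j * ∑ i ∈ Finset.range n, F j i ^ 2 := by
          rw [Finset.sum_comm]
          simp only [Finset.mul_sum]
        rw [e1, mul_pow, mul_pow, show s ^ 4 = (n : ℝ) ^ 2 by rw [← hs2]; ring, hs2]
        have e2 : ∀ j, τ j * (3 * (‖d‖ ^ 4 * ((n : ℝ)⁻¹ *
          ((∑ i ∈ Finset.range n, b i ^ 2) * ∑ i ∈ Finset.range n, F j i ^ 2)) +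
          ‖d‖ ^ 2 * ∑ l, M l j ^ 2 + (∑ l, c l j ^ 2) * ‖δ‖ ^ 2)) =
          (3 * ‖d‖ ^ 4 * (n : ℝ)⁻¹ * ∑ i ∈ Finset.range n, b i ^ 2) *
            (τ j * ∑ i ∈ Finset.range n, F j i ^ 2) + (3 * ‖d‖ ^ 2) * (τ j * ∑ l, M l j ^ 2) +
            (3 * ‖δ‖ ^ 2) * (τ j * ∑ l, c l j ^ 2) := fun j => by ring
        have e3 : ∀ l j, s⁻¹ * ∑ i ∈ Finset.range n, (g l i * F j i - c l j) = M l j :=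
          fun _ _ => rfl
        simp only [e2, e3, Finset.sum_add_distrib, ← Finset.mul_sum]
        field_simp

section Remainder

variable {α Ω : Type*} [MeasurableSpace α] [MeasurableSpace Ω] {P : Measure α}
  {μ : Measure Ω} {D : ℕ → Ω → α}

theorem integrable_average (hD : ∀ i, HasLaw (D i) P μ) {G : ℕ → α → ℝ}
    (hG : ∀ n, Integrable (G n) P) (n : ℕ) :
    Integrable (fun ω => (n : ℝ)⁻¹ * ∑ i ∈ Finset.range n, G n (D i ω)) μ := by
  refine Integrable.const_mul (integrable_finsetSum _ fun i _ => ?_) _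
  rw [← memLp_one_iff_integrable]
  exact memLp_comp_of_hasLaw (hD i) (memLp_one_iff_integrable.2 (hG n))

variable [IsProbabilityMeasure μ]

theorem isBigOProb_average (hD : ∀ i, HasLaw (D i) P μ) {G : ℕ → α → ℝ}
    (hG : ∀ n, Integrable (G n) P) (hnn : ∀ n a, 0 ≤ G n a) {C : ℝ} (hC : ∀ n, ∫ a, G n a ∂P ≤ C) :
    IsBigOProb μ (fun n ω => (n : ℝ)⁻¹ * ∑ i ∈ Finset.range n, G n (D i ω)) fun _ => 1 := by
  have hC0 : 0 ≤ C := (integral_nonneg (hnn 0)).trans (hC 0)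
  refine isBigOProb_one_of_integral_le (integrable_average hD hG)
    (fun n ω => mul_nonneg (by positivity) (Finset.sum_nonneg fun i _ => hnn n _)) (C := C)
    fun n => ?_
  have hi : ∀ i, Integrable (fun ω => G n (D i ω)) μ := fun i => by
    rw [← memLp_one_iff_integrable]
    exact memLp_comp_of_hasLaw (hD i) (memLp_one_iff_integrable.2 (hG n))
  have hv : ∀ i, ∫ ω, G n (D i ω) ∂μ = ∫ a, G n a ∂P := fun i =>
    (hD i).integral_comp (hG n).1
  rw [integral_const_mul, integral_finsetSum _ fun i _ => hi i, Finset.sum_congr rfl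
    fun i _ => hv i, Finset.sum_const, Finset.card_range, nsmul_eq_mul]
  rcases eq_or_ne n 0 with rfl | hn
  · simpa using hC0
  · rw [inv_mul_cancel_left₀ (by exact_mod_cast hn)]
    exact hC n

variable [IsProbabilityMeasure P]

/-- In the deterministic bound the first two terms are `n⁻¹` times quantities bounded in
probability, and the third is a bounded factor times an `o_p(1)`. Summability of `τ` makes every
bound uniform in the truncation `m n`. -/
theorem tendstoInMeasure_sum_sq_moment_remainder (hD : ∀ i, HasLaw (D i) P μ)
    (hind : iIndepFun D μ) {k : ℕ} {τ : ℕ → ℝ} (hτ : ∀ j, 0 ≤ τ j) (hτs : Summable τ)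
    {F : ℕ → α → ℝ} {U b : α → ℝ} {g h : Fin k → α → ℝ} {p : ℕ → Ω → α → ℝ} {d : ℕ → Ω → Vec k}
    {C : ℝ} (hF : ∀ j, MemLp (F j) 4 P) (hFC : ∀ j, ∫ x, F j x ^ 4 ∂P ≤ C)
    (hg : ∀ l, MemLp (g l) 4 P) (hgC : ∀ l, ∫ x, g l x ^ 4 ∂P ≤ C)
    (hb : Integrable (fun x => b x ^ 2) P)
    (hd : IsBigOProb μ (fun n ω => √(n : ℝ) * ‖d n ω‖) fun _ => 1)
    (hδ : TendstoInMeasure μ (fun (n : ℕ) ω => ‖√(n : ℝ) • d n ω - (√(n : ℝ))⁻¹ •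
      ∑ i ∈ Finset.range n, (WithLp.toLp 2 fun l => h l (D i ω) : Vec k)‖) atTop fun _ => 0)
    {B : ℕ → Set Ω} (hB : Tendsto (fun n => μ (B n)) atTop (𝓝 0))
    (hr : ∀ n, ∀ᵐ ω ∂μ, ω ∉ B n → ∀ i,
      |p n ω (D i ω) - ∑ l, g l (D i ω) * d n ω l| ≤ b (D i ω) * ‖d n ω‖ ^ 2)
    (m : ℕ → ℕ) :
    TendstoInMeasure μ (fun n ω => ∑ j ∈ Finset.range (m n),
      (√(τ j) * ((√(n : ℝ))⁻¹ * ∑ i ∈ Finset.range n,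
        (U (D i ω) - p n ω (D i ω)) * F j (D i ω)) -
      √(τ j) * ((√(n : ℝ))⁻¹ * ∑ i ∈ Finset.range n, (U (D i ω) * F j (D i ω) -
        ∑ l, (∫ x, F j x * g l x ∂P) * h l (D i ω)))) ^ 2) atTop fun _ => 0 := by
  have hC0 : 0 ≤ C := (integral_nonneg fun x => by positivity).trans (hFC 0)
  set c : Fin k → ℕ → ℝ := fun l j => ∫ x, F j x * g l x ∂P with hc
  have hFg : ∀ l j, MemLp (fun x => F j x * g l x) 2 P := fun l j => memLp_two_mul (hF j) (hg l)
  have hcsq : ∀ l j, c l j ^ 2 ≤ C := fun l j =>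
    (sq_integral_le (hFg l j)).trans (integral_mul_sq_le (hF j) (hg l) (hFC j) (hgC l))
  have hcent : ∀ l j, MemLp (fun x => g l x * F j x - c l j) 2 P := fun l j => by
    have h1 := (hFg l j).sub (memLp_const (c l j))
    refine h1.ae_eq (.of_forall fun x => ?_)
    simp [mul_comm]
  have hcent0 : ∀ l j, ∫ x, (g l x * F j x - c l j) ∂P = 0 := fun l j => by
    have h1 : Integrable (fun x => g l x * F j x) P := by
      simpa only [mul_comm] using (hFg l j).integrable one_le_two
    rw [integral_sub h1 (integrable_const _)]
    simp [hc, mul_comm]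
  have hcentC : ∀ l j, ∫ x, (g l x * F j x - c l j) ^ 2 ∂P ≤ C := fun l j => by
    have h1 := variance_eq_sub (hFg l j)
    rw [variance_eq_integral (hFg l j).aemeasurable] at h1
    have h2 : ∫ x, (g l x * F j x - c l j) ^ 2 ∂P =
        ∫ x, (F j x * g l x - ∫ x, F j x * g l x ∂P) ^ 2 ∂P := by simp only [hc, mul_comm]
    rw [h2, h1]
    have h3 := integral_mul_sq_le (hF j) (hg l) (hFC j) (hgC l)
    simp only [Pi.pow_apply]
    nlinarith [sq_nonneg (∫ x, F j x * g l x ∂P)]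
  have hτsum : ∀ m : ℕ, ∑ j ∈ Finset.range m, τ j ≤ ∑' j, τ j := fun m =>
    hτs.sum_le_tsum _ fun j _ => hτ j
  have hG := isBigOProb_average hD (G := fun _ x => b x ^ 2) (fun _ => hb)
    (fun _ _ => sq_nonneg _) (fun _ => le_rfl)
  have hH := isBigOProb_average hD (G := fun n x => ∑ j ∈ Finset.range (m n), τ j * F j x ^ 2)
    (fun n => integrable_finsetSum _ fun j _ =>
      ((MemLp.four_to_two (hF j)).integrable_sq).const_mul _)
    (fun n x => Finset.sum_nonneg fun j _ => mul_nonneg (hτ j) (sq_nonneg _))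
    (C := (∑' j, τ j) * (1 + C)) (fun n => by
      rw [integral_finsetSum _ fun j _ => ((MemLp.four_to_two (hF j)).integrable_sq).const_mul _]
      simp only [integral_const_mul]
      calc ∑ j ∈ Finset.range (m n), τ j * ∫ x, F j x ^ 2 ∂P
          ≤ ∑ j ∈ Finset.range (m n), τ j * (1 + C) := Finset.sum_le_sum fun j _ =>
            mul_le_mul_of_nonneg_left (integral_sq_le_one_add (hF j) (hFC j)) (hτ j)
        _ = (∑ j ∈ Finset.range (m n), τ j) * (1 + C) := by rw [Finset.sum_mul]
        _ ≤ _ := mul_le_mul_of_nonneg_right (hτsum _) (by linarith))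
  have hM : IsBigOProb μ (fun n ω => ∑ j ∈ Finset.range (m n), τ j * ∑ l,
      normSum D n (fun x => g l x * F j x - c l j) ω ^ 2) fun _ => 1 := by
    have hi : ∀ n j, Integrable (fun ω => τ j * ∑ l,
        normSum D n (fun x => g l x * F j x - c l j) ω ^ 2) μ := fun n j =>
      (integrable_finsetSum _ fun l _ => (memLp_normSum hD (hcent l j) n).integrable_sq).const_mul _
    refine isBigOProb_one_of_integral_le (fun n => integrable_finsetSum _ fun j _ => hi n j)
      (fun n ω => Finset.sum_nonneg fun j _ => mul_nonneg (hτ j)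
        (Finset.sum_nonneg fun l _ => sq_nonneg _)) (C := (∑' j, τ j) * (k * C)) fun n => ?_
    rw [integral_finsetSum _ fun j _ => hi n j]
    calc _ ≤ ∑ j ∈ Finset.range (m n), τ j * (k * C) := by
          refine Finset.sum_le_sum fun j _ => ?_
          rw [integral_const_mul]
          refine mul_le_mul_of_nonneg_left ?_ (hτ j)
          rw [integral_finsetSum _ fun l _ => (memLp_normSum hD (hcent l j) n).integrable_sq]
          refine (Finset.sum_le_card_nsmul _ _ C fun l _ => ?_).trans (by simp)
          exact (integral_normSum_sq_le hD hind (hcent l j) (hcent0 l j) n).trans (hcentC l j)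
      _ = (∑ j ∈ Finset.range (m n), τ j) * (k * C) := by rw [Finset.sum_mul]
      _ ≤ _ := mul_le_mul_of_nonneg_right (hτsum _) (by positivity)
  have hinv : TendstoInMeasure μ (fun (n : ℕ) (_ : Ω) => (n : ℝ)⁻¹) atTop fun _ => 0 :=
    tendstoInMeasure_zero_of_tendsto tendsto_inv_atTop_nhds_zero_nat
  have hd2 := hd.mul_one hd
  have t1 := ((hd2.mul_one hd2).mul_one (hG.mul_one hH)).mul_tendstoInMeasure_zero hinv
  have t2 := (hd2.mul_one hM).mul_tendstoInMeasure_zero hinv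
  have hδ2 : TendstoInMeasure μ (fun (n : ℕ) ω => ‖√(n : ℝ) • d n ω - (√(n : ℝ))⁻¹ •
      ∑ i ∈ Finset.range n, (WithLp.toLp 2 fun l => h l (D i ω) : Vec k)‖ ^ 2) atTop
      fun _ => 0 := by
    rw [tendstoInMeasure_zero_iff] at hδ ⊢
    intro ε hε
    refine (hδ (√ε) (Real.sqrt_pos.2 hε)).congr fun n => ?_
    congr 1
    ext ω
    simp only [Set.mem_ofPred_eq, abs_norm, abs_pow]
    exact Real.sqrt_le_left (norm_nonneg _)
  have hconst : ∀ a : ℝ, IsBigOProb μ (fun _ (_ : Ω) => a) fun _ => 1 := fun a ε hε =>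
    ⟨|a|, 0, fun n _ => by simp⟩
  have t3 := (hconst ((∑' j, τ j) * (k * C))).mul_tendstoInMeasure_zero hδ2
  have t := (hconst 3).mul_tendstoInMeasure_zero
    (TendstoInMeasure.add_zero (TendstoInMeasure.add_zero t1 t2) t3)
  refine tendstoInMeasure_zero_of_abs_le t hB ?_
  filter_upwards [eventually_ne_atTop 0] with n hn
  filter_upwards [hr n] with ω hω hωB
  rw [abs_of_nonneg (Finset.sum_nonneg fun j _ => sq_nonneg _)]
  refine (sum_sq_moment_remainder_le (m := m n) hn hτ (fun j i => F j (D i ω))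
    (fun i => U (D i ω)) (fun i => p n ω (D i ω)) (fun i => b (D i ω)) (fun l i => g l (D i ω))
    (fun l i => h l (D i ω)) c (d n ω) (hω hωB)).trans ?_
  have hcs : ∑ j ∈ Finset.range (m n), τ j * ∑ l, c l j ^ 2 ≤ (∑' j, τ j) * (k * C) := by
    calc _ ≤ ∑ j ∈ Finset.range (m n), τ j * (k * C) := by
          refine Finset.sum_le_sum fun j _ => mul_le_mul_of_nonneg_left ?_ (hτ j)
          exact (Finset.sum_le_card_nsmul _ _ C fun l _ => hcsq l j).trans (by simp)
      _ = (∑ j ∈ Finset.range (m n), τ j) * (k * C) := by rw [Finset.sum_mul]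
      _ ≤ _ := mul_le_mul_of_nonneg_right (hτsum _) (by positivity)
  refine mul_le_mul_of_nonneg_left (add_le_add (le_of_eq ?_)
    (mul_le_mul_of_nonneg_right hcs (sq_nonneg _))) (by norm_num)
  simp only [normSum]
  ring

end Remainder

/-! ### Assembling the expansion of the statistic. -/

/-- Expand the square of `T = Z + (T - Z)` and apply Cauchy–Schwarz: a tight `‖Z‖` and a vanishing
`‖T - Z‖` make the difference vanish. -/
theorem abs_sum_sq_sub_sum_sq_le {ι : Type*} (s : Finset ι) (T Z : ι → ℝ) :
    |∑ j ∈ s, T j ^ 2 - ∑ j ∈ s, Z j ^ 2| ≤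
      ∑ j ∈ s, (T j - Z j) ^ 2 + 2 * (√(∑ j ∈ s, Z j ^ 2) * √(∑ j ∈ s, (T j - Z j) ^ 2)) := by
  have h1 : ∑ j ∈ s, T j ^ 2 - ∑ j ∈ s, Z j ^ 2 =
      ∑ j ∈ s, (T j - Z j) ^ 2 + 2 * ∑ j ∈ s, Z j * (T j - Z j) := by
    rw [Finset.mul_sum, ← Finset.sum_sub_distrib, ← Finset.sum_add_distrib]
    exact Finset.sum_congr rfl fun j _ => by ring
  have h2 : |∑ j ∈ s, Z j * (T j - Z j)| ≤
      √(∑ j ∈ s, Z j ^ 2) * √(∑ j ∈ s, (T j - Z j) ^ 2) := by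
    rw [← Real.sqrt_mul (Finset.sum_nonneg fun j _ => sq_nonneg _)]
    exact Real.abs_le_sqrt (Finset.sum_mul_sq_le_sq_mul_sq _ _ _)
  have h3 : 0 ≤ ∑ j ∈ s, (T j - Z j) ^ 2 := Finset.sum_nonneg fun j _ => sq_nonneg _
  rw [h1]
  refine (abs_add_le _ _).trans ?_
  rw [abs_of_nonneg h3, abs_mul, abs_two]
  linarith

/-- Second order Taylor expansion of a smooth parametrization with a square integrable factor in
the remainder. -/
theorem SmoothParametrization.exists_taylor_bound {dz dw k : ℕ} {P : Measure (Obs dz dw)}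
    [IsProbabilityMeasure P] {φ : Vec dz → Vec k → ℝ} {Θ : Set (Vec k)} {θ₀ : Vec k}
    (hφ : SmoothParametrization P φ Θ θ₀) :
    ∃ b : Obs dz dw → ℝ, Integrable (fun x => b x ^ 2) P ∧ ∀ᵐ x ∂P, ∀ θ : Vec k,
      Metric.closedBall θ₀ ‖θ - θ₀‖ ⊆ interior Θ →
      |φ (obsZ x) θ - φ (obsZ x) θ₀ - ∑ l, partialD l (φ (obsZ x)) θ₀ * (θ l - θ₀ l)| ≤
        b x * ‖θ - θ₀‖ ^ 2 := by
  obtain ⟨η, -, -, hη⟩ := hφ.moments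
  set S : Fin k → Fin k → Obs dz dw → ℝ≥0∞ := fun j l x =>
    ⨆ θ ∈ interior Θ, ‖partialD j (partialD l (φ (obsZ x))) θ‖ₑ ^ 4 with hS
  set M : Obs dz dw → ℝ≥0∞ := fun x => ∑ j, ∑ l, S j l x with hM
  have hSm : ∀ j l, AEMeasurable (S j l) P := hφ.aemeasurable_sup
  have hMm : AEMeasurable M P :=
    Finset.aemeasurable_fun_sum _ fun j _ => Finset.aemeasurable_fun_sum _ fun l _ => hSm j l
  have hMi : ∫⁻ x, M x ∂P ≠ ∞ := by
    rw [lintegral_finsetSum' _ fun j _ => Finset.aemeasurable_fun_sum _ fun l _ => hSm j l]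
    refine (ENNReal.sum_lt_top.2 fun j _ => ?_).ne
    rw [lintegral_finsetSum' _ fun l _ => hSm j l]
    exact ENNReal.sum_lt_top.2 fun l _ => (hη j l).trans_lt ENNReal.ofReal_lt_top
  -- `M` dominates the fourth powers of all second partial derivatives, and `x² ≤ 1 + x⁴`, so the
  -- root bounds each of them; the factor `k²` is that of `abs_taylor_le`. Integrability of `M`
  -- gives that of the square.
  refine ⟨fun x => (k : ℝ) ^ 2 * √(1 + (M x).toReal), ?_, ?_⟩
  · have h : Integrable (fun x => ((k : ℝ) ^ 2) ^ 2 * (1 + (M x).toReal)) P :=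
      ((integrable_const _).add (integrable_toReal_of_lintegral_ne_top hMm hMi)).const_mul _
    refine h.congr (.of_forall fun x => ?_)
    simp only [mul_pow]
    rw [Real.sq_sqrt (by positivity)]
  filter_upwards [ae_lt_top' hMm hMi] with x hx θ hθ
  refine abs_taylor_le (hφ.differentiable (obsZ x)) hθ fun ξ hξ j l => ?_
  have h1 : ‖partialD j (partialD l (φ (obsZ x))) ξ‖ₑ ^ 4 ≤ M x :=
    calc _ ≤ S j l x := le_iSup₂ (f := fun θ (_ : θ ∈ interior Θ) =>
            ‖partialD j (partialD l (φ (obsZ x))) θ‖ₑ ^ 4) ξ hξ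
      _ ≤ ∑ l, S j l x := Finset.single_le_sum (f := fun l => S j l x)
          (fun _ _ => zero_le) (Finset.mem_univ l)
      _ ≤ M x := Finset.single_le_sum (f := fun j => ∑ l, S j l x)
          (fun _ _ => zero_le) (Finset.mem_univ j)
  have h2 : partialD j (partialD l (φ (obsZ x))) ξ ^ 4 ≤ (M x).toReal := by
    rw [Real.enorm_eq_ofReal_abs, ← ENNReal.ofReal_pow (abs_nonneg _), Even.pow_abs ⟨2, rfl⟩,
      ENNReal.ofReal_le_iff_le_toReal hx.ne] at h1
    exact h1
  refine Real.abs_le_sqrt ?_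
  nlinarith [sq_nonneg (partialD j (partialD l (φ (obsZ x))) ξ ^ 2 - 1),
    sq_nonneg (partialD j (partialD l (φ (obsZ x))) ξ)]

/-- As `m n → ∞`, each partial sum of the nonnegative series lies below one of the bounded sums. -/
theorem summable_of_sum_range_isBigO {τ : ℕ → ℝ} (hτ : ∀ j, 0 ≤ τ j) {m : ℕ → ℕ}
    (hm : Tendsto m atTop atTop)
    (h : (fun n => ∑ j ∈ Finset.range (m n), τ j) =O[atTop] fun _ => (1 : ℝ)) : Summable τ := by
  obtain ⟨C, hC⟩ := h.bound
  refine summable_of_sum_range_le hτ (c := C) fun N => ?_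
  obtain ⟨n, hn, hN⟩ := (hC.and (hm.eventually_ge_atTop N)).exists
  refine (Finset.sum_le_sum_of_subset_of_nonneg (Finset.range_mono hN) fun j _ _ => hτ j).trans ?_
  refine (Real.le_norm_self _).trans (hn.trans (by simp))

theorem IsBigOProb.rate_smul {Ω E : Type*} [MeasurableSpace Ω] [NormedAddCommGroup E]
    {μ : Measure Ω} {X : ℕ → Ω → E} (hX : IsBigOProb μ X fun n => (√(n : ℝ))⁻¹) :
    IsBigOProb μ (fun n ω => √(n : ℝ) * ‖X n ω‖) fun _ => 1 := by
  intro ε hε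
  obtain ⟨C, N, h⟩ := hX ε hε
  refine ⟨C, max N 1, fun n hn => le_trans (measure_mono fun ω hω => ?_)
    (h n ((le_max_left _ _).trans hn))⟩
  have hn0 : 0 < √(n : ℝ) :=
    Real.sqrt_pos.2 (by exact_mod_cast (le_max_right _ _).trans hn)
  simp only [Set.mem_ofPred_eq, norm_mul, norm_norm, Real.norm_of_nonneg hn0.le] at hω ⊢
  rw [← div_eq_mul_inv, div_lt_iff₀ hn0]
  linarith

theorem IsBigOProb.tendsto_measure_le_norm {Ω E : Type*} [MeasurableSpace Ω]
    [NormedAddCommGroup E] {μ : Measure Ω} {X : ℕ → Ω → E}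
    (hX : IsBigOProb μ X fun n => (√(n : ℝ))⁻¹) {r : ℝ} (hr : 0 < r) :
    Tendsto (fun n => μ {ω | r ≤ ‖X n ω‖}) atTop (𝓝 0) := by
  have h0 : Tendsto (fun n : ℕ => (√(n : ℝ))⁻¹) atTop (𝓝 0) :=
    (Real.tendsto_sqrt_atTop.comp tendsto_natCast_atTop_atTop).inv_tendsto_atTop
  have h := hX.rate_smul.mul_tendstoInMeasure_zero (tendstoInMeasure_zero_of_tendsto h0)
  rw [tendstoInMeasure_zero_iff] at h
  refine (h r hr).congr' ?_
  filter_upwards [eventually_ne_atTop 0] with n hn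
  have hn0 : 0 < √(n : ℝ) := Real.sqrt_pos.2 (by positivity)
  congr 1
  ext ω
  simp only [Set.mem_ofPred_eq]
  rw [mul_comm, inv_mul_cancel_left₀ hn0.ne', abs_norm]

section Score

variable {α : Type*} [MeasurableSpace α] {P : Measure α} [IsProbabilityMeasure P] {k : ℕ}

/-- The bound depends on `F` only through `C`. It therefore holds for all basis functions at once,
and the trace of the score covariance is at most a multiple of `∑ τ_j`. -/
theorem integral_sub_sum_mul_sq_le {U F : α → ℝ} {g h : Fin k → α → ℝ} {C : ℝ}
    (hU : MemLp U 4 P) (hUC : ∫ x, U x ^ 4 ∂P ≤ C) (hF : MemLp F 4 P)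
    (hFC : ∫ x, F x ^ 4 ∂P ≤ C) (hg : ∀ l, MemLp (g l) 4 P) (hgC : ∀ l, ∫ x, g l x ^ 4 ∂P ≤ C)
    (hh : ∀ l, MemLp (h l) 2 P) :
    ∫ x, (U x * F x - ∑ l, (∫ y, F y * g l y ∂P) * h l x) ^ 2 ∂P ≤
      2 * C + 2 * (k * C) * ∑ l, ∫ x, h l x ^ 2 ∂P := by
  have hC0 : 0 ≤ C := (integral_nonneg fun x => by positivity).trans hUC
  have hUF := memLp_two_mul hU hF
  have hc : ∑ l, (∫ y, F y * g l y ∂P) ^ 2 ≤ k * C :=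
    (Finset.sum_le_card_nsmul _ _ C fun l _ => (sq_integral_le (memLp_two_mul hF (hg l))).trans
      (integral_mul_sq_le hF (hg l) hFC (hgC l))).trans (by simp)
  have hh2 : Integrable (fun x => ∑ l, h l x ^ 2) P :=
    integrable_finsetSum _ fun l _ => (hh l).integrable_sq
  have hs : MemLp (fun x => ∑ l, (∫ y, F y * g l y ∂P) * h l x) 2 P :=
    memLp_finsetSum _ fun l _ => (hh l).const_mul _
  have h1 : ∫ x, (U x * F x - ∑ l, (∫ y, F y * g l y ∂P) * h l x) ^ 2 ∂P ≤
      ∫ x, (2 * (U x * F x) ^ 2 + 2 * (k * C) * ∑ l, h l x ^ 2) ∂P := by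
    refine integral_mono (hUF.sub hs).integrable_sq
      ((hUF.integrable_sq.const_mul 2).add (hh2.const_mul _)) fun x => ?_
    have h2 := Finset.sum_mul_sq_le_sq_mul_sq Finset.univ (fun l => ∫ y, F y * g l y ∂P)
      fun l => h l x
    have h3 : 0 ≤ ∑ l, h l x ^ 2 := Finset.sum_nonneg fun l _ => sq_nonneg _
    have h4 := mul_le_mul_of_nonneg_right hc h3
    simp only
    nlinarith [sq_nonneg (U x * F x + ∑ l, (∫ y, F y * g l y ∂P) * h l x)]
  rw [integral_add (hUF.integrable_sq.const_mul 2) (hh2.const_mul _), integral_const_mul,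
    integral_const_mul, integral_finsetSum _ fun l _ => (hh l).integrable_sq] at h1
  linarith [integral_mul_sq_le hU hF hUC hFC]

end Score

theorem score_eq {dz dw k : ℕ} (P : Measure (Obs dz dw)) (sol : Vec dz → ℝ)
    (φ : Vec dz → Vec k → ℝ) (θ₀ : Vec k) (h : Fin k → Obs dz dw × Vec k → ℝ)
    (f : ℕ → Vec dw → ℝ) (τ : ℕ → ℝ) (j : ℕ) (x : Obs dz dw) :
    score P sol φ θ₀ h f τ j x = √(τ j) * (err sol x * f j (obsW x) -
      ∑ l, (∫ y, f j (obsW y) * partialD l (φ (obsZ y)) θ₀ ∂P) * h l (x, θ₀)) := by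
  simp only [score, wBasis, mul_assoc, integral_const_mul, mul_sub, Finset.mul_sum]
  ring

theorem natCast_mul_testStat {dz dw k : ℕ} {φ : Vec dz → Vec k → ℝ} {f : ℕ → Vec dw → ℝ}
    {τ : ℕ → ℝ} (hτ : ∀ j, 0 ≤ τ j) (m n : ℕ) (θ : Vec k) (x : ℕ → Obs dz dw) :
    (n : ℝ) * testStat φ f τ m n θ x = ∑ j ∈ Finset.range m, (√(τ j) * ((√(n : ℝ))⁻¹ *
      ∑ i ∈ Finset.range n, (obsY (x i) - φ (obsZ (x i)) θ) * f j (obsW (x i)))) ^ 2 := by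
  rcases eq_or_ne n 0 with rfl | hn
  · simp
  have hn0 : (n : ℝ) ≠ 0 := by exact_mod_cast hn
  rw [testStat, Finset.mul_sum]
  refine Finset.sum_congr rfl fun j _ => ?_
  rw [sq_abs, mul_pow, mul_pow, mul_pow, Real.sq_sqrt (hτ j), inv_pow, inv_pow,
    Real.sq_sqrt n.cast_nonneg]
  field_simp

theorem aemeasurable_testStat {dz dw k : ℕ} {P : Measure (Obs dz dw)} {Ω : Type*}
    [MeasurableSpace Ω] {μ : Measure Ω} {φ : Vec dz → Vec k → ℝ}
    (hφ : Measurable fun q : Vec dz × Vec k => φ q.1 q.2) {f : ℕ → Vec dw → ℝ}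
    (hf : ∀ j, Measurable (f j)) (τ : ℕ → ℝ) {D : ℕ → Ω → Obs dz dw}
    (hD : ∀ i, HasLaw (D i) P μ) {θ : Ω → Vec k} (hθ : AEMeasurable θ μ) (m n : ℕ) :
    AEMeasurable (fun ω => testStat φ f τ m n (θ ω) fun i => D i ω) μ := by
  simp only [testStat, sq_abs]
  refine Finset.aemeasurable_fun_sum _ fun j _ => AEMeasurable.const_mul (AEMeasurable.pow_const
    (AEMeasurable.const_mul (Finset.aemeasurable_fun_sum _ fun i _ => ?_) _) 2) _
  have hDi := (hD i).aemeasurable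
  exact ((measurable_obsY.comp_aemeasurable hDi).sub
    (hφ.comp_aemeasurable ((measurable_obsZ.comp_aemeasurable hDi).prodMk hθ))).mul
    ((hf j).comp_aemeasurable (measurable_obsW.comp_aemeasurable hDi))


end NPIV

open NPIV in
theorem mainTheorem4 {dz dw k : ℕ}
    -- the joint law of `(Y, Z, W)` and the structural function
    (P : Measure (NPIV.Obs dz dw)) [IsProbabilityMeasure P]
    (sol : NPIV.Vec dz → ℝ) (hmodel : NPIV.IsModel P sol)
    -- basis functions, error moments and weights
    (ν : NPIV.Vec dw → ℝ) (hν : NPIV.IsProbDensity ν)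
    (f : ℕ → NPIV.Vec dw → ℝ) (hf : NPIV.IsOrthonormalBasisL2 ν f)
    (hbasis : NPIV.BasisCondition P ν f)
    (herr : NPIV.ErrorMomentCondition P sol)
    (τ : ℕ → ℝ) (hτ : NPIV.IsWeightSequence τ)
    -- the parametric null hypothesis
    (Θ : Set (NPIV.Vec k)) (hΘ : IsCompact Θ)
    (φ : NPIV.Vec dz → NPIV.Vec k → ℝ)
    (hnull : NPIV.ParametricNull P sol φ Θ)
    (θ₀ : NPIV.Vec k) (hθ₀ : θ₀ ∈ interior Θ)
    (hsol : NPIV.ParametricNull P sol φ Θ → ∀ᵐ x ∂P, sol (NPIV.obsZ x) = φ (NPIV.obsZ x) θ₀)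
    (hφ : NPIV.SmoothParametrization P φ Θ θ₀)
    -- the i.i.d. sample
    {Ω : Type*} [MeasurableSpace Ω] (μ : Measure Ω) [IsProbabilityMeasure μ]
    (D : ℕ → Ω → NPIV.Obs dz dw) (hD : ∀ i, HasLaw (D i) P μ) (hindep : iIndepFun D μ)
    -- the parameter estimator and its asymptotically linear representation
    (θhat : ℕ → Ω → NPIV.Vec k) (hθmeas : ∀ n, AEMeasurable (θhat n) μ)
    (hθrate : NPIV.IsBigOProb μ (fun n ω => θhat n ω - θ₀) (fun n => (√(n : ℝ))⁻¹))
    (h : Fin k → NPIV.Obs dz dw × NPIV.Vec k → ℝ)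
    (hh4 : ∀ l, MemLp (fun x => h l (x, θ₀)) 4 P)
    (hh0 : ∀ l, ∫ x, h l (x, θ₀) ∂P = 0)
    (hlin : TendstoInMeasure μ
      (fun (n : ℕ) ω => √(n : ℝ) • (θhat n ω - θ₀) -
        (√(n : ℝ))⁻¹ • ∑ i ∈ Finset.range n, WithLp.toLp 2 (fun l => h l (D i ω, θ₀)))
      atTop (fun _ => 0))
    -- the truncation parameter
    (m : ℕ → ℕ) (hm : Tendsto m atTop atTop)
    (hmτ : (fun n => ∑ j ∈ Finset.range (m n), τ j) =O[atTop] fun _ => (1 : ℝ))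
    -- independent chi-square variables with one degree of freedom
    {Ω' : Type*} [MeasurableSpace Ω'] (μ' : Measure Ω') [IsProbabilityMeasure μ']
    (χ : ℕ → Ω' → ℝ) (hχ : ∀ j, HasLaw (χ j) NPIV.chiSquareOne μ') (hχindep : iIndepFun χ μ') :
    ∃ lam : ℕ → ℝ,
      NPIV.IsOrderedEigenvalues (NPIV.covMatrix P sol φ θ₀ h f τ) lam ∧
      Summable lam ∧
      (∀ᵐ ω ∂μ', Summable fun j => lam j * χ j ω) ∧
      TendstoInDistribution
        (fun (n : ℕ) ω => (n : ℝ) * NPIV.testStat φ f τ (m n) n (θhat n ω) (fun i => D i ω))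
        atTop (fun ω => ∑' j, lam j * χ j ω) (fun _ => μ) μ' := by
  have hτ0 : ∀ j, 0 ≤ τ j := fun j => (hτ.pos j).le
  have hτs : Summable τ := summable_of_sum_range_isBigO hτ0 hm hmτ
  have hsol0 : ∀ᵐ x ∂P, sol (obsZ x) = φ (obsZ x) θ₀ := hsol hnull
  set g : Fin k → Obs dz dw → ℝ := fun l x => partialD l (φ (obsZ x)) θ₀ with hg_def
  have hgm : ∀ l, AEStronglyMeasurable (g l) P := fun l =>
    ((measurable_partialD_section hθ₀ hφ l).comp measurable_obsZ).aestronglyMeasurable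
  obtain ⟨Cf, hCf0, hCf⟩ := exists_moment_bound_basis hν hf hbasis
  obtain ⟨Cφ, hCφ1, hCφ, -⟩ := hφ.moments
  have hU : MemLp (err sol) 4 P :=
    memLp_four_of_integrable hmodel.integrable_err.aestronglyMeasurable herr.1
  have hg : ∀ l, MemLp (g l) 4 P := fun l => memLp_four_of_lintegral_le (hgm l) (hCφ l)
  have hF : ∀ j, MemLp (fun x => f j (obsW x)) 4 P := fun j => (hCf j).1
  have hh2 : ∀ l, MemLp (fun x => h l (x, θ₀)) 2 P := fun l => MemLp.four_to_two (hh4 l)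
  -- One constant for the fourth moments of the basis functions, the gradient and the error.
  set C : ℝ := max (max Cf Cφ) (∫ x, err sol x ^ 4 ∂P) with hC_def
  have hUC : ∫ x, err sol x ^ 4 ∂P ≤ C := le_max_right _ _
  have hFC : ∀ j, ∫ x, f j (obsW x) ^ 4 ∂P ≤ C := fun j =>
    (hCf j).2.trans ((le_max_left _ _).trans (le_max_left _ _))
  have hgC : ∀ l, ∫ x, g l x ^ 4 ∂P ≤ C := fun l =>
    (integral_pow_four_le_of_lintegral_le (hgm l) (by linarith) (hCφ l)).trans
      ((le_max_right _ _).trans (le_max_left _ _))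
  set s : ℕ → Obs dz dw → ℝ := fun j x => err sol x * f j (obsW x) -
    ∑ l, (∫ y, f j (obsW y) * g l y ∂P) * h l (x, θ₀) with hs_def
  have hscore : ∀ j, score P sol φ θ₀ h f τ j = fun x => √(τ j) * s j x := fun j =>
    funext fun x => score_eq P sol φ θ₀ h f τ j x
  have hUF : ∀ j, MemLp (fun x => err sol x * f j (obsW x)) 2 P := fun j => memLp_two_mul hU (hF j)
  have hch : ∀ j, MemLp (fun x => ∑ l, (∫ y, f j (obsW y) * g l y ∂P) * h l (x, θ₀)) 2 P :=
    fun j => memLp_finsetSum _ fun l _ => (hh2 l).const_mul _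
  have hs2 : ∀ j, MemLp (s j) 2 P := fun j => (hUF j).sub (hch j)
  have hs0 : ∀ j, ∫ x, s j x ∂P = 0 := fun j => by
    have h1 := integral_err_mul_eq_zero hmodel (hf.1 j) ((hUF j).integrable one_le_two)
    have h2 : ∫ x, ∑ l, (∫ y, f j (obsW y) * g l y ∂P) * h l (x, θ₀) ∂P = 0 := by
      rw [integral_finsetSum _ fun l _ => ((hh2 l).integrable one_le_two).const_mul _]
      simp [integral_const_mul, hh0]
    rw [hs_def]
    simp only
    rw [integral_sub ((hUF j).integrable one_le_two) ((hch j).integrable one_le_two), h1, h2,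
      sub_zero]
  set B : ℝ := 2 * C + 2 * (k * C) * ∑ l, ∫ x, h l (x, θ₀) ^ 2 ∂P with hB_def
  have hsB : ∀ j, ∫ x, s j x ^ 2 ∂P ≤ B := fun j =>
    integral_sub_sum_mul_sq_le hU hUC (hF j) (hFC j) hg hgC hh2
  have hX : ∀ j, MemLp (score P sol φ θ₀ h f τ j) 2 P := fun j => by
    rw [hscore]
    exact (hs2 j).const_mul _
  have hX0 : ∀ j, ∫ x, score P sol φ θ₀ h f τ j x ∂P = 0 := fun j => by
    rw [hscore]
    simp only [integral_const_mul, hs0, mul_zero]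
  have hXsq : ∀ j, ∫ x, score P sol φ θ₀ h f τ j x ^ 2 ∂P = τ j * ∫ x, s j x ^ 2 ∂P := fun j => by
    rw [hscore]
    simp only [mul_pow, Real.sq_sqrt (hτ0 j), integral_const_mul]
  have hXs : Summable fun j => ∫ x, score P sol φ θ₀ h f τ j x ^ 2 ∂P := by
    refine Summable.of_nonneg_of_le (fun j => integral_nonneg fun x => sq_nonneg _) (fun j => ?_)
      (hτs.mul_right B)
    rw [hXsq]
    exact mul_le_mul_of_nonneg_left (hsB j) (hτ0 j)
  -- The limit theorem is applied to the score vector; what remains is that the statistic differs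
  -- from its squared norm by `o_p(1)`.
  obtain ⟨lam, hord, hlam, hsum, hconv⟩ :=
    exists_tendstoInDistribution_weightedChiSquare hD hindep hχ hχindep hX hX0 hXs hm
  refine ⟨lam, hord, hlam, hsum, tendstoInDistribution_of_tendstoInMeasure_sub _ _ hconv ?_
    fun n => (aemeasurable_testStat hφ.measurable hf.1 τ hD (hθmeas n) (m n) n).const_mul _⟩
  obtain ⟨b, hb, hbT⟩ := hφ.exists_taylor_bound
  -- The expansion is used only when `θhat` is within `r` of `θ₀`, where the whole ball lies in the
  -- interior of `Θ`; the complementary event has vanishing probability.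
  obtain ⟨r, hr0, hrΘ⟩ := Metric.isOpen_iff.1 isOpen_interior θ₀ hθ₀
  set p : ℕ → Ω → Obs dz dw → ℝ := fun n ω x =>
    φ (obsZ x) (θhat n ω) - φ (obsZ x) θ₀ with hp_def
  have hrem := tendstoInMeasure_sum_sq_moment_remainder hD hindep hτ0 hτs
    (F := fun j x => f j (obsW x)) (U := err sol) (g := g) (h := fun l x => h l (x, θ₀))
    (p := p) (d := fun n ω => θhat n ω - θ₀) hF hFC hg hgC hb hθrate.rate_smul
    (by simpa [tendstoInMeasure_iff_norm] using hlin)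
    (hθrate.tendsto_measure_le_norm hr0) (fun n => by
      filter_upwards [ae_all_iff.2 fun i => ae_comp_of_hasLaw (hD i) hbT] with ω hω hωB i
      refine hω i (θhat n ω) (subset_trans (Metric.closedBall_subset_ball ?_) hrΘ)
      simpa using hωB) m
  have hZ : IsBigOProb μ (fun n ω => ∑ j ∈ Finset.range (m n),
      normSum D n (score P sol φ θ₀ h f τ j) ω ^ 2) fun _ => 1 := by
    refine isBigOProb_one_of_integral_le (fun n => integrable_finsetSum _ fun j _ =>
      (memLp_normSum hD (hX j) n).integrable_sq)
      (fun n ω => Finset.sum_nonneg fun j _ => sq_nonneg _)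
      (C := ∑' j, ∫ x, score P sol φ θ₀ h f τ j x ^ 2 ∂P) fun n => ?_
    rw [integral_finsetSum _ fun j _ => (memLp_normSum hD (hX j) n).integrable_sq]
    exact (Finset.sum_le_sum fun j _ => integral_normSum_sq_le hD hindep (hX j) (hX0 j) n).trans
      (hXs.sum_le_tsum _ fun j _ => integral_nonneg fun x => sq_nonneg _)
  have hconst : IsBigOProb μ (fun _ (_ : Ω) => (2 : ℝ)) fun _ => 1 := fun ε hε =>
    ⟨2, 0, fun n _ => by simp⟩
  refine tendstoInMeasure_zero_of_abs_le (B := fun _ => ∅)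
    (TendstoInMeasure.add_zero hrem (hconst.mul_tendstoInMeasure_zero
      (hZ.sqrt_one.mul_tendstoInMeasure_zero (tendstoInMeasure_zero_sqrt hrem))))
    (by simp) (.of_forall fun n => ?_)
  filter_upwards [ae_all_iff.2 fun i => ae_comp_of_hasLaw (hD i) hsol0] with ω hω _
  -- This is where the null hypothesis enters: the residual at `θ₀` is the error term.
  have hres : ∀ i, obsY (D i ω) - φ (obsZ (D i ω)) (θhat n ω) =
      err sol (D i ω) - p n ω (D i ω) := fun i => by
    simp only [err, hp_def, hω i]
    ring
  have hnorm : ∀ j, normSum D n (score P sol φ θ₀ h f τ j) ω =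
      √(τ j) * ((√(n : ℝ))⁻¹ * ∑ i ∈ Finset.range n, s j (D i ω)) := fun j => by
    rw [hscore, normSum, ← Finset.mul_sum]
    ring
  simp only [Pi.sub_apply, natCast_mul_testStat hτ0, hres, hnorm]
  exact abs_sum_sq_sub_sum_sq_le _ _ _
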